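/- Let $G=(V\cup\{s,g\},E)$ be a directed acyclic graph with source $s$ and sink $g$, in which no edge enters $s$ or leaves $g$ and every $v\in V$ lies on an $s$-$g$ path. Write $e_-$ for the tail of an edge $e$, $\partial_+v$ for the set of edges leaving $v$, $n=|V|$, $m=|E|$, $\mathcal P\subseteq\{0,1\}^E$ for the set of $s$-$g$ paths, $\mathcal Q=\mathrm{conv}(\mathcal P)$, and $q(v)=\sum_{e\in\partial_+v}q(e)$ for $q\in\mathbb R^E$. In each round $t=1,\dots,T$ the environment chooses $\ell_t\in\mathbb R_{\ge0}^E$ with $\langle\ell_t,p\rangle\le1$ for all $p\in\mathcal P$, possibly depending on the past and on $q_t$. The player, holding $q_t\in\mathcal Q$, samples a path $p_t\in\mathcal P$ by starting at $s$ and leaving each visited vertex $v\neq g$ through $e\in\partial_+v$ with probability $q_t(e)/q_t(v)$. The player then observes $c_t\in[0,1]$ whose conditional expectation given the past, $\ell_t$ and $p_t$ is $\langle\ell_t,p_t\rangle$. Let $\mathrm{Reg}_T(p^*)=\mathbf E\sum_{t=1}^T\langle\ell_t,p_t-p^*\rangle$ and $\mathrm{Reg}_T=\max_{p^*\in\mathcal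 P}\mathrm{Reg}_T(p^*)$. The player runs FTRL: $$q_t\in\arg\min_{q\in\mathcal Q}\Big\{\Big\langle\sum_{\tau<t}\widehat\ell_\tau,q\Big\rangle+\psi_t(q)\Big\},\qquad \widehat\ell_t(e)=c_t\Big(\frac{p_t(e)}{q_t(e)}-\frac{p_t(e_-)}{q_t(e_-)}\Big).$$ There is a universal constant $C>0$ such that the following holds for every such graph, every $T$ and every such environment. (i) (Tsallis regularizer.) Let $\psi_t(q)=-2\sqrt t\sum_{e}\sqrt{q(e)}-2\sum_{e}\ln q(e)$. Let $p^*\in\mathcal P$, let $V^*\subseteq V$ be the set of vertices of $V$ on $p^*$, and let $\pi^*:V\cup\{s\}\to E$ satisfy $\pi^*(v)\in\partial_+v$ for all $v$, and $\pi^*(e_-)=e$ whenever $p^*(e)=1$. Then $$\mathrm{Reg}_T(p^*)\le C\Big(\sum_{t=1}^T\frac1{\sqrt t}\,\mathbf E\Big[\sum_{v\in V\cup\{s\}}\ \sum_{e\in\partial_+v\setminus\{\pi^*(v)\}}\sqrt{q_t(e)}+\sum_{v\in V\setminus V^*}\sqrt{q_t(\pi^*(v))}\Big]+m\log T\Big),$$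 and the expression in the outer parentheses is at most $$\sum_{t=1}^T\frac1{\sqrt t}\,\mathbf E\Big[\sum_{v\in V\cup\{s\}}\ \sum_{e\in\partial_+v\setminus\{\pi^*(v)\}}\sqrt{q_t(e)}+n\sqrt{\sum_{v\in V^*\cup\{s\}}\ \sum_{e\in\partial_+v\setminus\{\pi^*(v)\}}q_t(e)}\Big]+m\log T.$$ (ii) (Adaptive log-barrier.) Let $T\ge2$ and $$\psi_t(q)=-\sum_e\frac{\ln q(e)}{\eta_t(e)},\quad \eta_t(e)=\Big(4+\frac1{\ln T}\sum_{\tau<t}\rho_\tau(e)\Big)^{-1/2},\quad \rho_t(e)=c_t^2\,p_t(e_-)\Big(p_t(e)-\frac{q_t(e)}{q_t(e_-)}\Big)^2.$$ Then $$\mathrm{Reg}_T\le C\Big(\mathbf E\Big[\sum_{v\in V\cup\{s\}}\ \sum_{e\in\partial_+v}\sqrt{\sum_{t=1}^Tc_t^2\,p_t(v)\Big(p_t(e)-\frac{q_t(e)}{q_t(v)}\Big)^2\log T}\ \Big]+m\log T\Big).$$ -/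

import Mathlib

open MeasureTheory

/-- A directed acyclic graph with a source and a sink. `W` is the set of all vertices,
`V ∪ {s, g}` with `s = source` and `g = sink`, and `E` is the set of edges; the edge `e` goes from
`tail e` to `head e`. No edge leaves the sink or enters the source, and every vertex other than the
source and the sink lies on a path from the source to the sink. -/
structure FlowNetwork (W E : Type*) where
  tail : E → W
  head : E → W
  source : W
  sink : W
  source_ne_sink : source ≠ sink
  tail_ne_sink : ∀ e, tail e ≠ sink
  head_ne_source : ∀ e, head e ≠ source
  acyclic : ∀ v, ¬ Relation.TransGen (fun a b => ∃ e, tail e = a ∧ head e = b) v v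
  on_path : ∀ v, v ≠ source → v ≠ sink →
    Relation.ReflTransGen (fun a b => ∃ e, tail e = a ∧ head e = b) source v ∧
      Relation.ReflTransGen (fun a b => ∃ e, tail e = a ∧ head e = b) v sink

namespace FlowNetwork

section

variable {W E : Type*} (G : FlowNetwork W E)

/-- The edges in the list, in this order, form a walk from `u` to `v`. -/
def IsWalk : W → List E → W → Prop
  | u, [], v => u = v
  | u, e :: l, v => G.tail e = u ∧ IsWalk (G.head e) l v

/-- The `0/1` vectors of the paths from the source to the sink
(in an acyclic graph every walk is a path). -/
def paths : Set (E → ℝ) :=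
  {x | ∃ l : List E, G.IsWalk G.source l G.sink ∧ x = Set.indicator {e | e ∈ l} 1}

/-- The polytope of unit flows from the source to the sink. -/
def flows : Set (E → ℝ) := convexHull ℝ G.paths

/-- A map that picks an outgoing edge at every vertex other than the sink (its value at the sink is
irrelevant), and at the vertices of the path `x` picks the edge of the path. -/
def Consistent (x : E → ℝ) (π : W → E) : Prop :=
  (∀ v, v ≠ G.sink → G.tail (π v) = v) ∧ ∀ e, x e = 1 → π (G.tail e) = e

variable [Fintype E] [DecidableEq W]

/-- `x(v)`, the sum of `x` over the edges that leave `v`. -/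
noncomputable def nodeFlow (x : E → ℝ) (v : W) : ℝ := ∑ e with G.tail e = v, x e

/-- The probability of the path `x` when a path is built from the source to the sink by leaving
each vertex `v` that is reached through the edge `e` with probability `q(e) / q(v)`. -/
noncomputable def pathProb (q x : E → ℝ) : ℝ :=
  ∏ e with x e = 1, q e / G.nodeFlow q (G.tail e)

/-- The loss estimator, from the path `x` that was played, the point `q` it was sampled from
and the feedback `c`. -/
noncomputable def lossEstimate (q x : E → ℝ) (c : ℝ) (e : E) : ℝ :=
  c * (x e / q e - G.nodeFlow x (G.tail e) / G.nodeFlow q (G.tail e))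

/-- The quantity `ρ(e)` that drives the learning rates of the log-barrier regularizer. -/
noncomputable def rho (q x : E → ℝ) (c : ℝ) (e : E) : ℝ :=
  c ^ 2 * G.nodeFlow x (G.tail e) * (x e - q e / G.nodeFlow q (G.tail e)) ^ 2

/-- `q` minimizes `⟨L, ·⟩ + ψ` over the flow polytope, for a regularizer `ψ` with a logarithmic
barrier. As `- ln 0 = + ∞`, the minimization runs over the flows that are positive on
every edge. -/
def IsFTRLPoint (L : E → ℝ) (ψ : (E → ℝ) → ℝ) (q : E → ℝ) : Prop :=
  q ∈ G.flows ∧ (∀ e, 0 < q e) ∧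
    ∀ q' ∈ G.flows, (∀ e, 0 < q' e) → ∑ e, L e * q e + ψ q ≤ ∑ e, L e * q' e + ψ q'

end

end FlowNetwork

/-- The Tsallis regularizer of round `t`, with `η_t = 1 / √t` and `β = 2`. -/
noncomputable def tsallisReg {E : Type*} [Fintype E] (t : ℕ) (q : E → ℝ) : ℝ :=
  -(2 / (1 / √(t : ℝ))) * ∑ e, √(q e) - ∑ e, 2 * Real.log (q e)

/-- The log-barrier regularizer with learning rates `η`. -/
noncomputable def logBarrierReg {E : Type*} [Fintype E] (η : E → ℝ) (q : E → ℝ) : ℝ :=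
  -∑ e, 1 / η e * Real.log (q e)

/-- The online shortest path protocol over the rounds `1, …, T`. In round `t` the environment picks
the losses `ℓ t`, the player holds `q t` and samples the path `p t` from it edge by edge, and then
observes `c t`. The sigma-algebra `ℱ t` holds what has happened up to the choice of `ℓ t`
(all earlier losses, paths and feedback, and any randomness of the environment). -/
structure BanditRun {W E Ω : Type*} [Fintype E] [DecidableEq W] [mΩ : MeasurableSpace Ω]
    (G : FlowNetwork W E) (T : ℕ) (μ : Measure Ω) where
  ℱ : Filtration ℕ mΩ
  ℓ : ℕ → Ω → E → ℝ
  q : ℕ → Ω → E → ℝ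
  p : ℕ → Ω → E → ℝ
  c : ℕ → Ω → ℝ
  measurable_ℓ : ∀ t ∈ Finset.Icc 1 T, Measurable[ℱ t] (ℓ t)
  measurable_q : ∀ t ∈ Finset.Icc 1 T, Measurable[ℱ t] (q t)
  measurable_p : ∀ t ∈ Finset.Icc 1 T, Measurable[ℱ (t + 1)] (p t)
  measurable_c : ∀ t ∈ Finset.Icc 1 T, Measurable[ℱ (t + 1)] (c t)
  ℓ_nonneg : ∀ t ∈ Finset.Icc 1 T, ∀ ω e, 0 ≤ ℓ t ω e
  ℓ_path_le_one : ∀ t ∈ Finset.Icc 1 T, ∀ ω, ∀ x ∈ G.paths, ∑ e, ℓ t ω e * x e ≤ 1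
  p_mem : ∀ t ∈ Finset.Icc 1 T, ∀ ω, p t ω ∈ G.paths
  p_law : ∀ t ∈ Finset.Icc 1 T, ∀ x ∈ G.paths,
    μ[Set.indicator {ω | p t ω = x} (fun _ => (1 : ℝ)) | ℱ t]
      =ᵐ[μ] fun ω => G.pathProb (q t ω) x
  c_mem : ∀ t ∈ Finset.Icc 1 T, ∀ ω, c t ω ∈ Set.Icc (0 : ℝ) 1
  c_mean : ∀ t ∈ Finset.Icc 1 T,
    μ[c t | ℱ t ⊔ MeasurableSpace.comap (p t) inferInstance]
      =ᵐ[μ] fun ω => ∑ e, ℓ t ω e * p t ω e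

namespace BanditRun

section

variable {W E Ω : Type*} [Fintype E] [DecidableEq W] [MeasurableSpace Ω]
  {G : FlowNetwork W E} {T : ℕ} {μ : Measure Ω} (R : BanditRun G T μ)

/-- The sum of the loss estimators of the rounds before `t`. -/
noncomputable def cumLoss (t : ℕ) (ω : Ω) (e : E) : ℝ :=
  ∑ τ ∈ Finset.Ico 1 t, G.lossEstimate (R.q τ ω) (R.p τ ω) (R.c τ ω) e

/-- The learning rate `η_t(e)` of the log-barrier regularizer. -/
noncomputable def logBarrierRate (t : ℕ) (ω : Ω) (e : E) : ℝ :=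
  1 / √(4 + 1 / Real.log T *
    ∑ τ ∈ Finset.Ico 1 t, G.rho (R.q τ ω) (R.p τ ω) (R.c τ ω) e)

/-- The player runs FTRL with the Tsallis regularizer. -/
def UsesTsallis : Prop :=
  ∀ t ∈ Finset.Icc 1 T, ∀ ω, G.IsFTRLPoint (R.cumLoss t ω) (tsallisReg t) (R.q t ω)

/-- The player runs FTRL with the adaptive log-barrier regularizer. -/
def UsesLogBarrier : Prop :=
  ∀ t ∈ Finset.Icc 1 T, ∀ ω,
    G.IsFTRLPoint (R.cumLoss t ω) (logBarrierReg (R.logBarrierRate t ω)) (R.q t ω)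

/-- The regret against the fixed path `x`. -/
noncomputable def regretAgainst (x : E → ℝ) : ℝ :=
  ∫ ω, ∑ t ∈ Finset.Icc 1 T, ∑ e, R.ℓ t ω e * (R.p t ω e - x e) ∂μ

/-- The regret, the maximum over all fixed paths (there are finitely many). -/
noncomputable def regret : ℝ := ⨆ x : G.paths, R.regretAgainst x

end

end BanditRun

set_option linter.unusedSectionVars false

/-! The loss estimator is `c` times an importance weight, and that weight is a martingale increment:
it is nonzero only when the walk visits the tail of `e`, and there it compares the edge taken with
its conditional probability. Let `h(v)` be the expected loss still to come from `v`. The estimator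
of `e` then has conditional mean `ℓ(e) + h(head e) - h(tail e)`. This is not `ℓ(e)`, but the error
is a potential difference, and along a unit flow it telescopes to `-h(source)`, minus the expected
loss of the player. So against any fixed flow `u`, `-⟨ℓ̂, u⟩` is an unbiased estimate of the regret
of the round (`walkMean_loss_sub`, `integral_loss_sub`). Moreover `⟨ℓ̂, q⟩ = 0` identically, so this
is also the FTRL regret on the estimated losses.

The regret splits into stability and penalty (`IsFTRLPoint.step`, `ftrl_regret`). Stability is local
because `|q ℓ̂| ≤ 1` on every edge and the logarithmic barrier has weight at least 2. It costs `(q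
ℓ̂)²` over `√t √q` for Tsallis and over the barrier weight for the log-barrier, up to constants
(`tsallis_stability`, `logBarrier_stability`).

For Tsallis, `(q ℓ̂)²` has conditional mean at most `q(e) (1 - q(e)/q(v))`, with `v` the tail of
`e`. At each vertex the factor `1 - q(e)/q(v)` of the selected edge is the share of the other edges,
so only unselected edges are charged. In the penalty, `√q ≤ 1` cancels against the comparator on the
edges of the path, leaving the edges off it. These are either unselected or selected at a vertex off
the path. The second form of the bound holds because flow through a vertex off the path must have
left the path through an unselected edge.

For the log-barrier, `(q ℓ̂)²` equals `ρ`, the weights are built from past values of `ρ`, and both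
stability and penalty are of order `√(∑ ρ · log T)`.

The barrier is infinite at a path, so the comparator is mixed with weight `1/T` with a flow of at
least `1/m` on each edge. This costs a total bias of 1 and `O(m log T)` in the barrier when `m ≤ T`.
If `2 ≤ T < m` the trivial bound `T` suffices. The case `T = 1`, where `log T = 0`, is separate for
Tsallis. -/

namespace FlowNetwork

/-! ### Walks in an acyclic graph -/

section Walks

variable {W E : Type*} (G : FlowNetwork W E)

/-- There is an edge from `a` to `b`. -/
def Step (a b : W) : Prop := ∃ e, G.tail e = a ∧ G.head e = b

variable {G}

theorem IsWalk.reaches_tail {u v : W} {l : List E} (h : G.IsWalk u l v) {e : E} (he : e ∈ l) :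
    Relation.ReflTransGen G.Step u (G.tail e) := by
  induction l generalizing u with
  | nil => simp at he
  | cons a l ih =>
    obtain ⟨h1, h2⟩ := h
    rcases List.mem_cons.1 he with rfl | he
    · rw [h1]
    · exact (ih h2 he).head ⟨a, h1, rfl⟩

theorem IsWalk.tail_ne {a : E} {v : W} {l : List E} (h : G.IsWalk (G.head a) l v) {e : E}
    (he : e ∈ l) : G.tail e ≠ G.tail a := by
  intro h'
  have := h.reaches_tail he
  rw [h'] at this
  exact G.acyclic _ (Relation.TransGen.head' ⟨a, rfl, rfl⟩ this)

theorem IsWalk.notMem {a : E} {v : W} {l : List E} (h : G.IsWalk (G.head a) l v) : a ∉ l :=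
  fun ha => h.tail_ne ha rfl

theorem IsWalk.nodup {u v : W} {l : List E} (h : G.IsWalk u l v) : l.Nodup := by
  induction l generalizing u with
  | nil => simp
  | cons a l ih => exact List.nodup_cons.2 ⟨h.2.notMem, ih h.2⟩

theorem IsWalk.append {u v w : W} {l l' : List E} (h : G.IsWalk u l v) (h' : G.IsWalk v l' w) :
    G.IsWalk u (l ++ l') w := by
  induction l generalizing u with
  | nil => cases h; exact h'
  | cons a l ih => exact ⟨h.1, ih h.2⟩

theorem exists_isWalk {u v : W} (h : Relation.ReflTransGen G.Step u v) :
    ∃ l, G.IsWalk u l v := by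
  induction h using Relation.ReflTransGen.head_induction_on with
  | refl => exact ⟨[], rfl⟩
  | head h _ ih =>
    obtain ⟨e, rfl, rfl⟩ := h
    obtain ⟨l, hl⟩ := ih
    exact ⟨e :: l, rfl, hl⟩

/-- Both first edges leave `u`, and acyclicity forbids a later edge from leaving `u` again, so the
edge set determines the order. Hence passing from walks to `0/1` vectors loses nothing. -/
theorem isWalk_eq_of_mem_iff {u v : W} {l l' : List E} (h : G.IsWalk u l v)
    (h' : G.IsWalk u l' v) (hl : ∀ e, e ∈ l ↔ e ∈ l') : l = l' := by
  induction l generalizing u l' with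
  | nil =>
    cases l' with
    | nil => rfl
    | cons a l' => simpa using hl a
  | cons a l ih =>
    cases l' with
    | nil => simpa using hl a
    | cons b l' =>
      obtain rfl : a = b := by
        rcases List.mem_cons.1 ((hl b).2 (by simp)) with hb | hb
        · exact hb.symm
        · exact absurd (h'.1.trans h.1.symm) (h.2.tail_ne hb)
      rw [ih h.2 h'.2]
      intro e
      have := hl e
      by_cases he : e = a
      · subst he
        simp [h.2.notMem, h'.2.notMem]
      · simpa [he] using this

/-- Reachability is a strict order on a finite set, hence well-founded. All laws of the random walk
are proved by this backward recursion from the sink. -/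
theorem vertex_induction [Finite W] {P : W → Prop}
    (h : ∀ u, (∀ e, G.tail e = u → P (G.head e)) → P u) (u : W) : P u := by
  let r : W → W → Prop := fun a b => Relation.TransGen G.Step b a
  have : IsTrans W r := ⟨fun a b c h1 h2 => h2.trans h1⟩
  have : Std.Irrefl r := ⟨fun a h => G.acyclic a h⟩
  have wf : WellFounded r := Finite.wellFounded_of_trans_of_irrefl r
  induction u using wf.induction with
  | h u ih => exact h u fun e he => ih _ (Relation.TransGen.single ⟨e, he, rfl⟩)

theorem exists_isWalk_source_sink_mem (e : E) :
    ∃ l, G.IsWalk G.source l G.sink ∧ e ∈ l := by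
  have h1 : Relation.ReflTransGen G.Step G.source (G.tail e) := by
    by_cases h : G.tail e = G.source
    · rw [h]
    · exact (G.on_path _ h (G.tail_ne_sink e)).1
  have h2 : Relation.ReflTransGen G.Step (G.head e) G.sink := by
    by_cases h : G.head e = G.sink
    · rw [h]
    · exact (G.on_path _ (G.head_ne_source e) h).2
  obtain ⟨l, hl⟩ := exists_isWalk h1
  obtain ⟨l', hl'⟩ := exists_isWalk h2
  exact ⟨l ++ e :: l', hl.append ⟨rfl, hl'⟩, by simp⟩

/-- The `0/1` vector of a list of edges. -/
noncomputable def edgeVec (l : List E) : E → ℝ := Set.indicator {e | e ∈ l} 1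

theorem edgeVec_of_mem {l : List E} {e : E} (h : e ∈ l) : edgeVec l e = 1 := by
  simp [edgeVec, h]

theorem edgeVec_of_notMem {l : List E} {e : E} (h : e ∉ l) : edgeVec l e = 0 := by
  simp [edgeVec, h]

theorem edgeVec_eq_one_iff {l : List E} {e : E} : edgeVec l e = 1 ↔ e ∈ l := by
  by_cases h : e ∈ l <;> simp [edgeVec, h]

theorem edgeVec_nil : edgeVec ([] : List E) = 0 := by
  ext e; simp [edgeVec]

theorem edgeVec_cons [DecidableEq E] {a : E} {l : List E} (h : a ∉ l) :
    edgeVec (a :: l) = Pi.single a 1 + edgeVec l := by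
  ext e
  by_cases he : e = a
  · subst he; simp [edgeVec, h]
  · by_cases h' : e ∈ l <;> simp [edgeVec, he, h']

theorem mem_paths {x : E → ℝ} :
    x ∈ G.paths ↔ ∃ l : List E, G.IsWalk G.source l G.sink ∧ x = edgeVec l := Iff.rfl

theorem paths_zero_or_one {x : E → ℝ} (hx : x ∈ G.paths) (e : E) : x e = 0 ∨ x e = 1 := by
  obtain ⟨l, -, rfl⟩ := hx
  by_cases h : e ∈ l <;> simp [h]

theorem sum_mul_edgeVec [Fintype E] {l : List E} (hl : l.Nodup) (f : E → ℝ) :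
    ∑ e, f e * edgeVec l e = (l.map f).sum := by
  classical
  induction l with
  | nil => simp [edgeVec_nil]
  | cons a l ih =>
    rw [List.nodup_cons] at hl
    simp [edgeVec_cons hl.1, mul_add, Finset.sum_add_distrib, ih hl.2, Pi.single_apply]

theorem finite_walks [Finite E] (u : W) : {l : List E | G.IsWalk u l G.sink}.Finite := by
  have := Fintype.ofFinite E
  classical
  have : Finite {l : List E | l.Nodup} := inferInstanceAs (Finite {l : List E // l.Nodup})
  exact (Set.toFinite {l : List E | l.Nodup}).subset fun l hl => hl.nodup

variable (G) in
/-- The walks from `u` to the sink. -/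
noncomputable def walks [Finite E] (u : W) : Finset (List E) :=
  (finite_walks (G := G) u).toFinset

theorem mem_walks [Finite E] {u : W} {l : List E} : l ∈ G.walks u ↔ G.IsWalk u l G.sink := by
  simp [walks]

variable [Fintype E]

theorem sum_walks_sink (F : List E → ℝ) : ∑ l ∈ G.walks G.sink, F l = F [] := by
  have : G.walks G.sink = {[]} := by
    ext l
    rw [mem_walks, Finset.mem_singleton]
    cases l with
    | nil => simp [IsWalk]
    | cons a l => simp [IsWalk, G.tail_ne_sink]
  simp [this]

theorem sum_walks [DecidableEq W] {u : W} (hu : u ≠ G.sink) (F : List E → ℝ) :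
    ∑ l ∈ G.walks u, F l = ∑ e with G.tail e = u, ∑ l ∈ G.walks (G.head e), F (e :: l) := by
  rw [Finset.sum_sigma']
  symm
  refine Finset.sum_bij (fun x _ => x.1 :: x.2) ?_ ?_ ?_ ?_
  · rintro ⟨e, l⟩ h
    simp only [Finset.mem_sigma, Finset.mem_filter, mem_walks] at h
    exact mem_walks.2 ⟨h.1.2, h.2⟩
  · rintro ⟨e, l⟩ _ ⟨e', l'⟩ _ h
    simp only [List.cons.injEq] at h
    obtain ⟨rfl, rfl⟩ := h
    rfl
  · intro l hl
    rw [mem_walks] at hl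
    cases l with
    | nil => exact absurd hl hu
    | cons a l =>
      exact ⟨⟨a, l⟩, by simpa [mem_walks, IsWalk] using hl, rfl⟩
  · simp

end Walks

/-! ### Unit flows as the convex hull of paths -/

section Flows

variable {W E : Type*} {G : FlowNetwork W E}

theorem paths_subset_flows : G.paths ⊆ G.flows := subset_convexHull ℝ _

theorem IsWalk.sum_map_sub {u v : W} {l : List E} (hl : G.IsWalk u l v) (h : W → ℝ) :
    (l.map fun e => h (G.head e) - h (G.tail e)).sum = h v - h u := by
  induction l generalizing u with
  | nil => cases hl; simp
  | cons a l ih => simp [ih hl.2, hl.1]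

variable [Fintype E]

/-- A half-space that contains the paths contains their convex hull. All linear facts about flows,
conservation included, are obtained by checking them on paths. -/
theorem sum_le_of_mem_flows {a : E → ℝ} {b : ℝ} (h : ∀ x ∈ G.paths, ∑ e, a e * x e ≤ b)
    {y : E → ℝ} (hy : y ∈ G.flows) : ∑ e, a e * y e ≤ b := by
  have hlin : IsLinearMap ℝ (fun y : E → ℝ => ∑ e, a e * y e) :=
    ⟨fun x y => by simp [mul_add, Finset.sum_add_distrib],
      fun c x => by simp only [Pi.smul_apply, smul_eq_mul, Finset.mul_sum]; congr! 1; ring⟩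
  have hsub : G.paths ⊆ {y | ∑ e, a e * y e ≤ b} := h
  exact convexHull_min hsub (convex_halfSpace_le hlin b) hy

theorem sum_eq_of_mem_flows {a : E → ℝ} {b : ℝ} (h : ∀ x ∈ G.paths, ∑ e, a e * x e = b)
    {y : E → ℝ} (hy : y ∈ G.flows) : ∑ e, a e * y e = b := by
  apply le_antisymm (sum_le_of_mem_flows (fun x hx => (h x hx).le) hy)
  have := sum_le_of_mem_flows (a := -a) (b := -b) (fun x hx => by simp [h x hx]) hy
  simpa using this

theorem flows_nonneg {y : E → ℝ} (hy : y ∈ G.flows) (e : E) : 0 ≤ y e := by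
  classical
  have := sum_le_of_mem_flows (a := -Pi.single e 1) (b := 0) (fun x hx => by
    rcases paths_zero_or_one hx e with h | h <;> simp [Pi.single_apply, h]) hy
  simpa [Pi.single_apply] using this

theorem flows_le_one {y : E → ℝ} (hy : y ∈ G.flows) (e : E) : y e ≤ 1 := by
  classical
  have := sum_le_of_mem_flows (a := Pi.single e 1) (b := 1) (fun x hx => by
    rcases paths_zero_or_one hx e with h | h <;> simp [Pi.single_apply, h]) hy
  simpa [Pi.single_apply] using this

/-- Summation by parts for unit flows. -/
theorem sum_potential_of_mem_flows {y : E → ℝ} (hy : y ∈ G.flows) (h : W → ℝ) :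
    ∑ e, (h (G.head e) - h (G.tail e)) * y e = h G.sink - h G.source := by
  refine sum_eq_of_mem_flows (fun x hx => ?_) hy
  obtain ⟨l, hl, rfl⟩ := mem_paths.1 hx
  rw [sum_mul_edgeVec hl.nodup, hl.sum_map_sub]

variable (G) in
/-- A unit flow that puts at least the mass `1 / m` on each of the `m` edges. -/
theorem exists_spread_flow [Nonempty E] :
    ∃ y ∈ G.flows, ∀ e, 1 / (Fintype.card E : ℝ) ≤ y e := by
  choose l hl hmem using exists_isWalk_source_sink_mem (G := G)
  have hm : (0 : ℝ) < Fintype.card E := by exact_mod_cast Fintype.card_pos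
  refine ⟨∑ a : E, (1 / (Fintype.card E : ℝ)) • edgeVec (l a), ?_, fun e => ?_⟩
  · refine (convex_convexHull ℝ G.paths).sum_mem (fun _ _ => by positivity) ?_ fun a _ =>
      paths_subset_flows ⟨l a, hl a, rfl⟩
    simp [hm.ne']
  · rw [Finset.sum_apply]
    have := Finset.single_le_sum (f := fun a => ((1 / (Fintype.card E : ℝ)) • edgeVec (l a)) e)
      (fun a _ => mul_nonneg (by positivity)
        (flows_nonneg (paths_subset_flows ⟨l a, hl a, rfl⟩) e)) (Finset.mem_univ e)
    refine le_trans (le_of_eq ?_) this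
    simp [edgeVec_of_mem (hmem e)]

variable [DecidableEq W]

theorem nodeFlow_add (x y : E → ℝ) (v : W) :
    G.nodeFlow (x + y) v = G.nodeFlow x v + G.nodeFlow y v := by
  simp [nodeFlow, Finset.sum_add_distrib]

theorem nodeFlow_single [DecidableEq E] (a : E) (v : W) :
    G.nodeFlow (Pi.single a 1) v = if G.tail a = v then 1 else 0 := by
  by_cases h : G.tail a = v <;> simp [nodeFlow, Pi.single_apply, Finset.sum_ite_eq', h]

theorem nodeFlow_edgeVec_eq_zero {l : List E} {v : W} (h : ∀ e ∈ l, G.tail e ≠ v) :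
    G.nodeFlow (edgeVec l) v = 0 := by
  refine Finset.sum_eq_zero fun e he => edgeVec_of_notMem fun hl => h e hl ?_
  simpa using he

theorem IsWalk.nodeFlow_eq_zero_or_one {u w : W} {l : List E} (hl : G.IsWalk u l w) (v : W) :
    G.nodeFlow (edgeVec l) v = 0 ∨ G.nodeFlow (edgeVec l) v = 1 := by
  classical
  induction l generalizing u with
  | nil => left; simp [nodeFlow, edgeVec_nil]
  | cons a l ih =>
    rw [edgeVec_cons hl.2.notMem, nodeFlow_add, nodeFlow_single]
    by_cases h : G.tail a = v
    · subst h
      right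
      rw [nodeFlow_edgeVec_eq_zero fun e he => hl.2.tail_ne he]
      simp
    · simpa [h] using ih hl.2

theorem nodeFlow_path {x : E → ℝ} (hx : x ∈ G.paths) (v : W) :
    G.nodeFlow x v = 0 ∨ G.nodeFlow x v = 1 := by
  obtain ⟨l, hl, rfl⟩ := mem_paths.1 hx
  exact hl.nodeFlow_eq_zero_or_one v

theorem le_nodeFlow {y : E → ℝ} (hy : ∀ e, 0 ≤ y e) (e : E) : y e ≤ G.nodeFlow y (G.tail e) :=
  Finset.single_le_sum (f := y) (fun a _ => hy a) (by simp)

theorem nodeFlow_eq_one_of_path {x : E → ℝ} (hx : x ∈ G.paths) {e : E} (he : x e = 1) :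
    G.nodeFlow x (G.tail e) = 1 := by
  have := le_nodeFlow (G := G) (fun a => flows_nonneg (paths_subset_flows hx) a) e
  rcases nodeFlow_path hx (G.tail e) with h | h
  · linarith
  · exact h

theorem exists_of_nodeFlow_eq_one {x : E → ℝ} (hx : x ∈ G.paths) {v : W}
    (hv : G.nodeFlow x v = 1) : ∃ e, G.tail e = v ∧ x e = 1 := by
  by_contra! h
  have : G.nodeFlow x v = 0 := Finset.sum_eq_zero fun e he =>
    (paths_zero_or_one hx e).resolve_right (h e (by simpa using he))
  linarith

theorem nodeFlow_source_path {x : E → ℝ} (hx : x ∈ G.paths) : G.nodeFlow x G.source = 1 := by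
  obtain ⟨l, hl, rfl⟩ := id hx
  cases l with
  | nil => exact absurd hl G.source_ne_sink
  | cons a l =>
    rw [← hl.1]
    exact nodeFlow_eq_one_of_path hx (edgeVec_of_mem (by simp))

theorem nodeFlow_pos_of_ne_sink {q : E → ℝ} (hq : q ∈ G.flows) (hpos : ∀ e, 0 < q e) {v : W}
    (hv : v ≠ G.sink) : 0 < G.nodeFlow q v := by
  obtain ⟨e, rfl⟩ : ∃ e, G.tail e = v := by
    by_cases hs : v = G.source
    · obtain ⟨x, hx⟩ : G.paths.Nonempty := by
        rw [← convexHull_nonempty_iff (𝕜 := ℝ)]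
        exact ⟨q, hq⟩
      obtain ⟨e, he, -⟩ := exists_of_nodeFlow_eq_one hx (nodeFlow_source_path hx)
      exact ⟨e, he.trans hs.symm⟩
    · rcases (Relation.ReflTransGen.cases_head (G.on_path v hs hv).2) with h | ⟨_, ⟨e, he, -⟩, -⟩
      · exact absurd h hv
      · exact ⟨e, he⟩
  exact (hpos e).trans_le (le_nodeFlow (fun a => (hpos a).le) e)

theorem nodeFlow_eq_sum (y : E → ℝ) (v : W) :
    G.nodeFlow y v = ∑ e, (if G.tail e = v then 1 else 0) * y e := by
  simp [nodeFlow, Finset.sum_filter]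

/-- Flow through a vertex off the path `x` must have left the path `x` somewhere. -/
theorem nodeFlow_le_sum_leaving [Fintype W] [DecidableEq E] {x : E → ℝ} (hx : x ∈ G.paths) {π : W → E}
    (hπ : G.Consistent x π) {v : W} (hvx : G.nodeFlow x v ≠ 1)
    {y : E → ℝ} (hy : y ∈ G.flows) :
    G.nodeFlow y v ≤ ∑ w with w = G.source ∨ (w ≠ G.sink ∧ G.nodeFlow x w = 1),
      ∑ e with G.tail e = w ∧ e ≠ π w, y e := by
  classical
  -- The right-hand side is one linear functional of the flow, with coefficient 1 on the unselected
  -- edges whose tail lies on `x`. The inequality then needs checking only on single paths `z`.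
  have key : ∀ y : E → ℝ, ∑ w with w = G.source ∨ (w ≠ G.sink ∧ G.nodeFlow x w = 1),
      ∑ e with G.tail e = w ∧ e ≠ π w, y e =
      ∑ e, (if G.nodeFlow x (G.tail e) = 1 ∧ e ≠ π (G.tail e) then 1 else 0) * y e := by
    intro y
    have h1 : ∀ w, (w = G.source ∨ (w ≠ G.sink ∧ G.nodeFlow x w = 1)) ↔ G.nodeFlow x w = 1 := by
      intro w
      constructor
      · rintro (rfl | h)
        exacts [nodeFlow_source_path hx, h.2]
      · intro h
        right
        refine ⟨?_, h⟩
        rintro rfl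
        obtain ⟨e, he, -⟩ := exists_of_nodeFlow_eq_one hx h
        exact G.tail_ne_sink e he
    simp only [h1]
    simp only [Finset.sum_filter]
    rw [← Finset.sum_fiberwise (s := Finset.univ) (g := G.tail)]
    refine Finset.sum_congr rfl fun w _ => ?_
    rw [Finset.sum_filter]
    by_cases hw : G.nodeFlow x w = 1
    · rw [if_pos hw]
      refine Finset.sum_congr rfl fun e _ => ?_
      by_cases he : G.tail e = w
      · subst he; simp [hw]
      · simp [he]
    · rw [if_neg hw]
      symm
      refine Finset.sum_eq_zero fun e _ => ?_
      by_cases he : G.tail e = w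
      · subst he; simp [hw]
      · simp [he]
  rw [key, nodeFlow_eq_sum, ← sub_nonpos, ← Finset.sum_sub_distrib]
  simp only [← sub_mul]
  refine sum_le_of_mem_flows (fun z hz => ?_) hy
  simp only [sub_mul]
  rw [Finset.sum_sub_distrib, sub_nonpos, ← nodeFlow_eq_sum]
  set f : E → ℝ := fun e => if G.nodeFlow x (G.tail e) = 1 ∧ e ≠ π (G.tail e) then 1 else 0
  have hnn : ∀ e, 0 ≤ f e * z e := fun e => mul_nonneg (by simp only [f]; split_ifs <;> norm_num)
    (flows_nonneg (paths_subset_flows hz) e)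
  rcases nodeFlow_path hz v with h0 | h1
  · rw [h0]; exact Finset.sum_nonneg fun e _ => hnn e
  rw [h1]
  obtain ⟨a, ha, hza⟩ := exists_of_nodeFlow_eq_one hz h1
  obtain ⟨e, he1, he2, he3⟩ : ∃ e, z e = 1 ∧ G.nodeFlow x (G.tail e) = 1 ∧ e ≠ π (G.tail e) := by
    obtain ⟨lx, hlx, rfl⟩ := mem_paths.1 hx
    obtain ⟨l, hl, rfl⟩ := mem_paths.1 hz
    rw [edgeVec_eq_one_iff] at hza
    by_contra! hcon
    have hstart := nodeFlow_source_path hx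
    simp only [edgeVec_eq_one_iff] at hcon
    -- A walk that starts on `x` and always takes the selected edge at vertices of `x` follows `x`,
    -- so it cannot pass through `v`, which is off `x`.
    have main : ∀ (l : List E) (u : W), G.IsWalk u l G.sink →
        G.nodeFlow (edgeVec lx) u = 1 → (∀ e ∈ l, G.nodeFlow (edgeVec lx) (G.tail e) = 1 →
          e = π (G.tail e)) → a ∈ l → False := by
      intro l
      induction l with
      | nil => simp
      | cons b l ih =>
        rintro u ⟨hb, hl⟩ hu hc hal
        rcases List.mem_cons.1 hal with rfl | hal
        · exact hvx (by rw [← ha, hb, hu])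
        · have hbx : b ∈ lx := by
            obtain ⟨e, he, hex⟩ := exists_of_nodeFlow_eq_one hx hu
            have h2 := hπ.2 e hex
            rw [he, ← hb, ← hc b (by simp) (by rw [hb, hu])] at h2
            rw [h2]
            exact edgeVec_eq_one_iff.1 hex
          have hbs : G.head b ≠ G.sink := by
            intro hs
            rw [hs] at hl
            cases l with
            | nil => simp at hal
            | cons d l => exact G.tail_ne_sink d hl.1
          refine ih (G.head b) hl ?_ (fun e he => hc e (by simp [he])) hal
          -- With the indicator of `head b` as potential, summation by parts is flow conservation at
          -- `head b`: `x` enters through `b`, so it also leaves.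
          have := sum_potential_of_mem_flows (paths_subset_flows hx)
            (fun w => if w = G.head b then 1 else 0)
          simp only [if_neg hbs.symm, if_neg (G.head_ne_source b).symm, sub_mul,
            Finset.sum_sub_distrib, sub_self] at this
          rw [← nodeFlow_eq_sum, sub_eq_zero] at this
          rcases nodeFlow_path hx (G.head b) with h | h
          · rw [h] at this
            have h3 := Finset.single_le_sum
              (f := fun e => (if G.head e = G.head b then (1 : ℝ) else 0) * edgeVec lx e)
              (fun e _ => mul_nonneg (by split_ifs <;> norm_num)
                (flows_nonneg (paths_subset_flows hx) e)) (Finset.mem_univ b)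
            simp only [this, edgeVec_of_mem hbx] at h3
            norm_num at h3
          · exact h
    exact main l _ hl hstart hcon hza
  have := Finset.single_le_sum (f := fun e => f e * z e) (fun e _ => hnn e) (Finset.mem_univ e)
  simpa [f, he1, he2, he3] using this

end Flows

end FlowNetwork

namespace FlowNetwork

/-! ### Laws of the sampled path -/

section Sampling

variable {W E : Type*} (G : FlowNetwork W E) [Fintype E] [DecidableEq W]

/-- The expectation of `F` at the random walk to the sink that starts at `u` and leaves each vertex
`v` through `e` with probability `q(e) / q(v)`. -/
noncomputable def walkMean (q : E → ℝ) (u : W) (F : (E → ℝ) → ℝ) : ℝ :=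
  ∑ l ∈ G.walks u, (l.map fun e => q e / G.nodeFlow q (G.tail e)).prod * F (edgeVec l)

/-- The indicator of a traversal of `e`, divided by `q(e)`, minus that of a visit of its tail,
divided by the flow through the tail. -/
noncomputable def importance (q : E → ℝ) (e : E) (x : E → ℝ) : ℝ :=
  x e / q e - G.nodeFlow x (G.tail e) / G.nodeFlow q (G.tail e)

/-- The `0/1` vectors of the source-sink paths, as a finite set. -/
noncomputable def pathFinset : Finset (E → ℝ) := by
  classical exact (G.walks G.source).image edgeVec

variable {G}

theorem mem_pathFinset {x : E → ℝ} : x ∈ G.pathFinset ↔ x ∈ G.paths := by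
  simp only [pathFinset, Finset.mem_image, mem_walks, mem_paths]
  exact ⟨fun ⟨l, h, h'⟩ => ⟨l, h, h'.symm⟩, fun ⟨l, h, h'⟩ => ⟨l, h, h'.symm⟩⟩

theorem pathProb_edgeVec (q : E → ℝ) {l : List E} (hl : l.Nodup) :
    G.pathProb q (edgeVec l) = (l.map fun e => q e / G.nodeFlow q (G.tail e)).prod := by
  classical
  have : (Finset.univ.filter fun e => edgeVec l e = 1) = l.toFinset := by
    ext e; simp [edgeVec_eq_one_iff]
  rw [pathProb, this, List.prod_toFinset _ hl]

/-- The law of the played path is given on `0/1` vectors, while recursion over the first edge needs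
walks. The two agree because a walk is determined by its edge set. -/
theorem sum_pathProb_mul (q : E → ℝ) (F : (E → ℝ) → ℝ) :
    ∑ x ∈ G.pathFinset, G.pathProb q x * F x = G.walkMean q G.source F := by
  classical
  rw [pathFinset, Finset.sum_image, walkMean]
  · refine Finset.sum_congr rfl fun l hl => ?_
    rw [pathProb_edgeVec q (mem_walks.1 hl).nodup]
  · intro l hl l' hl' h
    refine isWalk_eq_of_mem_iff (mem_walks.1 hl) (mem_walks.1 hl') fun e => ?_
    rw [← edgeVec_eq_one_iff, ← edgeVec_eq_one_iff]
    simp only [h]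

theorem walkMean_sink (q : E → ℝ) (F : (E → ℝ) → ℝ) : G.walkMean q G.sink F = F 0 := by
  rw [walkMean, sum_walks_sink]
  simp [edgeVec_nil]

theorem walkMean_step [DecidableEq E] (q : E → ℝ) {u : W} (hu : u ≠ G.sink)
    (F : (E → ℝ) → ℝ) :
    G.walkMean q u F = ∑ e with G.tail e = u,
      q e / G.nodeFlow q u * G.walkMean q (G.head e) fun x => F (Pi.single e 1 + x) := by
  rw [walkMean, sum_walks hu]
  refine Finset.sum_congr rfl fun e he => ?_
  rw [walkMean, Finset.mul_sum]
  refine Finset.sum_congr rfl fun l hl => ?_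
  have he' : G.tail e = u := by simpa using he
  rw [edgeVec_cons (mem_walks.1 hl).notMem, List.map_cons, List.prod_cons, he']
  ring

theorem walkMean_add (q : E → ℝ) (u : W) (F F' : (E → ℝ) → ℝ) :
    G.walkMean q u (fun x => F x + F' x) = G.walkMean q u F + G.walkMean q u F' := by
  simp [walkMean, mul_add, Finset.sum_add_distrib]

theorem walkMean_const_mul (q : E → ℝ) (u : W) (a : ℝ) (F : (E → ℝ) → ℝ) :
    G.walkMean q u (fun x => a * F x) = a * G.walkMean q u F := by
  rw [walkMean, walkMean, Finset.mul_sum]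
  exact Finset.sum_congr rfl fun l _ => by ring

theorem walkMean_sum {ι : Type*} (s : Finset ι) (q : E → ℝ) (u : W)
    (F : ι → (E → ℝ) → ℝ) :
    G.walkMean q u (fun x => ∑ i ∈ s, F i x) = ∑ i ∈ s, G.walkMean q u (F i) := by
  simp only [walkMean, Finset.mul_sum]
  exact Finset.sum_comm

theorem walkMean_congr (q : E → ℝ) {F F' : (E → ℝ) → ℝ} (h : ∀ x ∈ G.paths, F x = F' x) :
    G.walkMean q G.source F = G.walkMean q G.source F' := by
  rw [← sum_pathProb_mul, ← sum_pathProb_mul]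
  exact Finset.sum_congr rfl fun x hx => by rw [h x (mem_pathFinset.1 hx)]

theorem sum_div_nodeFlow {q : E → ℝ} {u : W} (hu : 0 < G.nodeFlow q u) :
    ∑ e with G.tail e = u, q e / G.nodeFlow q u = 1 := by
  rw [← Finset.sum_div]
  exact div_self hu.ne'

section Laws

variable [Finite W] [DecidableEq E] {q : E → ℝ}

theorem walkMean_one (hpos : ∀ v, v ≠ G.sink → 0 < G.nodeFlow q v) (u : W) :
    G.walkMean q u (fun _ => 1) = 1 := by
  induction u using vertex_induction (G := G) with
  | h u ih =>
    by_cases hu : u = G.sink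
    · subst hu; exact walkMean_sink _ _
    · rw [walkMean_step q hu]
      refine (Finset.sum_congr rfl fun e he => ?_).trans (sum_div_nodeFlow (hpos u hu))
      rw [ih e (by simpa using he), mul_one]

theorem walkMean_const (hpos : ∀ v, v ≠ G.sink → 0 < G.nodeFlow q v) (u : W) (a : ℝ) :
    G.walkMean q u (fun _ => a) = a := by
  have := walkMean_const_mul (G := G) q u a (fun _ => 1)
  simpa [walkMean_one hpos] using this

/-- Additivity along the walk separates the contribution of the first edge from that of the rest,
which is what makes the weight a sum of increments. -/
theorem importance_add (e : E) (x y : E → ℝ) :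
    G.importance q e (x + y) = G.importance q e x + G.importance q e y := by
  simp only [importance, nodeFlow_add, Pi.add_apply]
  ring

theorem importance_zero (e : E) : G.importance q e 0 = 0 := by
  simp [importance, nodeFlow]

theorem importance_single (e a : E) : G.importance q e (Pi.single a 1) =
    (if a = e then 1 / q e else 0) -
      if G.tail a = G.tail e then 1 / G.nodeFlow q (G.tail e) else 0 := by
  rw [importance, nodeFlow_single, Pi.single_apply]
  by_cases h1 : a = e
  · subst h1; simp
  · by_cases h2 : G.tail a = G.tail e <;> simp [h1, h2, Ne.symm h1]

/-- The mean over one step out of `u`. Away from the tail of `e` the increment vanishes. At the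
tail, the weight `1 / q e` picks out `f e` and the correction subtracts the mean of `f`, so
constants average to zero. -/
theorem sum_div_mul_importance (hq : ∀ e, q e ≠ 0) (e : E) (f : E → ℝ) (u : W) :
    ∑ a with G.tail a = u, q a / G.nodeFlow q u * (G.importance q e (Pi.single a 1) * f a) =
      if u = G.tail e then
        (f e - ∑ a with G.tail a = u, q a / G.nodeFlow q u * f a) / G.nodeFlow q u else 0 := by
  by_cases hu : u = G.tail e
  · subst hu
    rw [if_pos rfl]
    have h1 : ∀ a ∈ Finset.univ.filter (fun a => G.tail a = G.tail e),
        q a / G.nodeFlow q (G.tail e) * (G.importance q e (Pi.single a 1) * f a) =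
        (if a = e then f e / G.nodeFlow q (G.tail e) else 0) -
          q a / G.nodeFlow q (G.tail e) * f a / G.nodeFlow q (G.tail e) := by
      intro a ha
      have ha' : G.tail a = G.tail e := by simpa using ha
      rw [importance_single, if_pos ha']
      by_cases h : a = e
      · subst h
        have := hq a
        rw [if_pos rfl, if_pos rfl]
        have h2 : q a / G.nodeFlow q (G.tail a) * (1 / q a * f a) =
          f a / G.nodeFlow q (G.tail a) := by field_simp
        linear_combination h2
      · simp only [if_neg h]; ring
    rw [Finset.sum_congr rfl h1, Finset.sum_sub_distrib, ← Finset.sum_div, sub_div]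
    simp
  · rw [if_neg hu]
    refine Finset.sum_eq_zero fun a ha => ?_
    have ha' : G.tail a = u := by simpa using ha
    rw [importance_single, if_neg (by rintro rfl; exact hu ha'.symm), if_neg (by rw [ha']; exact hu)]
    simp

/-- Every increment has mean zero: it is the one-step identity with `f = 1`. -/
theorem walkMean_importance (hq : ∀ e, q e ≠ 0)
    (hpos : ∀ v, v ≠ G.sink → 0 < G.nodeFlow q v) (e : E) (u : W) :
    G.walkMean q u (G.importance q e) = 0 := by
  induction u using vertex_induction (G := G) with
  | h u ih =>
    by_cases hu : u = G.sink
    · subst hu; rw [walkMean_sink, importance_zero]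
    · rw [walkMean_step q hu]
      have : ∀ a ∈ Finset.univ.filter (fun a => G.tail a = u),
          q a / G.nodeFlow q u *
            G.walkMean q (G.head a) (fun x => G.importance q e (Pi.single a 1 + x)) =
          q a / G.nodeFlow q u * (G.importance q e (Pi.single a 1) * 1) := by
        intro a ha
        simp only [importance_add]
        rw [walkMean_add, walkMean_const hpos, ih a (by simpa using ha)]
        ring
      rw [Finset.sum_congr rfl this, sum_div_mul_importance hq]
      simp [sum_div_nodeFlow (hpos u hu)]

/-- The expected loss of the random walk from `u` to the sink. -/
noncomputable def lossToGo (G : FlowNetwork W E) (q ℓ : E → ℝ) (u : W) : ℝ :=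
  G.walkMean q u fun x => ∑ e, ℓ e * x e

theorem lossToGo_sink (ℓ : E → ℝ) : G.lossToGo q ℓ G.sink = 0 := by
  simp [lossToGo, walkMean_sink]

theorem sum_mul_single_add (ℓ x : E → ℝ) (a : E) :
    ∑ e, ℓ e * (Pi.single a 1 + x : E → ℝ) e = ℓ a + ∑ e, ℓ e * x e := by
  simp [mul_add, Finset.sum_add_distrib, Pi.single_apply]

theorem lossToGo_step (hpos : ∀ v, v ≠ G.sink → 0 < G.nodeFlow q v) (ℓ : E → ℝ) {u : W}
    (hu : u ≠ G.sink) : G.lossToGo q ℓ u =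
      ∑ a with G.tail a = u, q a / G.nodeFlow q u * (ℓ a + G.lossToGo q ℓ (G.head a)) := by
  rw [lossToGo, walkMean_step q hu]
  refine Finset.sum_congr rfl fun a _ => ?_
  simp_rw [sum_mul_single_add]
  rw [walkMean_add, walkMean_const hpos]
  rfl

theorem nodeFlow_single_add (x : E → ℝ) (a : E) (v : W) :
    G.nodeFlow (Pi.single a 1 + x) v = (if G.tail a = v then 1 else 0) + G.nodeFlow x v := by
  rw [nodeFlow_add, nodeFlow_single]

/-- By acyclicity a walk that has crossed `e` never returns to its tail. -/
theorem walkMean_nodeFlow_head (e : E) :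
    G.walkMean q (G.head e) (fun x => G.nodeFlow x (G.tail e)) = 0 := by
  refine Finset.sum_eq_zero fun l hl => ?_
  simp only [nodeFlow_edgeVec_eq_zero fun a ha => (mem_walks.1 hl).tail_ne ha, mul_zero]

theorem walkMean_nodeFlow_step (hpos : ∀ v, v ≠ G.sink → 0 < G.nodeFlow q v) {u : W}
    (hu : u ≠ G.sink) (v : W) :
    G.walkMean q u (fun x => G.nodeFlow x v) = (if u = v then 1 else 0) +
      ∑ a with G.tail a = u,
        q a / G.nodeFlow q u * G.walkMean q (G.head a) fun x => G.nodeFlow x v := by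
  have h1 : (if u = v then (1 : ℝ) else 0) =
      ∑ a with G.tail a = u, (if u = v then 1 else 0) * (q a / G.nodeFlow q u) := by
    rw [← Finset.mul_sum, sum_div_nodeFlow (hpos u hu), mul_one]
  rw [walkMean_step q hu, h1, ← Finset.sum_add_distrib]
  refine Finset.sum_congr rfl fun a ha => ?_
  have ha' : G.tail a = u := by simpa using ha
  simp_rw [nodeFlow_single_add]
  rw [walkMean_add, walkMean_const hpos, ha']
  ring

theorem walkMean_nodeFlow_self (hpos : ∀ v, v ≠ G.sink → 0 < G.nodeFlow q v) {v : W}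
    (hv : v ≠ G.sink) : G.walkMean q v (fun x => G.nodeFlow x v) = 1 := by
  rw [walkMean_nodeFlow_step hpos hv, if_pos rfl, Finset.sum_eq_zero, add_zero]
  intro a ha
  obtain rfl : G.tail a = v := by simpa using ha
  rw [walkMean_nodeFlow_head, mul_zero]

/-- Loss incurred before the tail of `e` multiplies a mean-zero increment and drops out. What is
left is the advantage of taking `e` over a random step from its tail, weighted by the probability of
getting there. -/
theorem walkMean_loss_mul_importance (hq : ∀ e, q e ≠ 0)
    (hpos : ∀ v, v ≠ G.sink → 0 < G.nodeFlow q v) (ℓ : E → ℝ) (e : E) (u : W) :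
    G.walkMean q u (fun x => (∑ a, ℓ a * x a) * G.importance q e x) =
      (ℓ e + G.lossToGo q ℓ (G.head e) - G.lossToGo q ℓ (G.tail e)) /
        G.nodeFlow q (G.tail e) * G.walkMean q u (fun x => G.nodeFlow x (G.tail e)) := by
  induction u using vertex_induction (G := G) with
  | h u ih =>
    by_cases hu : u = G.sink
    · subst hu; rw [walkMean_sink, walkMean_sink]; simp [nodeFlow]
    · rw [walkMean_nodeFlow_step hpos hu, walkMean_step q hu]
      have : ∀ a ∈ Finset.univ.filter (fun a => G.tail a = u),
          q a / G.nodeFlow q u * G.walkMean q (G.head a) (fun x =>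
            (∑ b, ℓ b * (Pi.single a 1 + x : E → ℝ) b) * G.importance q e (Pi.single a 1 + x)) =
          q a / G.nodeFlow q u *
            (G.importance q e (Pi.single a 1) * (ℓ a + G.lossToGo q ℓ (G.head a))) +
          (ℓ e + G.lossToGo q ℓ (G.head e) - G.lossToGo q ℓ (G.tail e)) /
            G.nodeFlow q (G.tail e) * (q a / G.nodeFlow q u *
              G.walkMean q (G.head a) (fun x => G.nodeFlow x (G.tail e))) := by
        intro a ha
        have h1 : (fun x : E → ℝ => (∑ b, ℓ b * (Pi.single a 1 + x : E → ℝ) b) *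
            G.importance q e (Pi.single a 1 + x)) = fun x =>
            (ℓ a * G.importance q e (Pi.single a 1) +
            G.importance q e (Pi.single a 1) * ∑ b, ℓ b * x b) +
            (ℓ a * G.importance q e x + (∑ b, ℓ b * x b) * G.importance q e x) := by
          funext x
          rw [sum_mul_single_add, importance_add]
          ring
        rw [h1, walkMean_add, walkMean_add, walkMean_add, walkMean_const hpos,
          walkMean_const_mul, walkMean_const_mul, walkMean_importance hq hpos,
          ih a (by simpa using ha)]
        simp only [lossToGo]
        ring
      rw [Finset.sum_congr rfl this, Finset.sum_add_distrib, sum_div_mul_importance hq,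
        ← Finset.mul_sum, mul_add]
      congr 1
      by_cases h : u = G.tail e
      · subst h
        rw [if_pos rfl, if_pos rfl, ← lossToGo_step hpos ℓ hu, mul_one]
      · simp [h]

end Laws

section FlowLaws

variable [Finite W] [DecidableEq E] {q : E → ℝ} (hq : q ∈ G.flows) (hpos : ∀ e, 0 < q e)
include hq hpos

/-- The probability `h(u)` of visiting `v` from `u` is a potential that is harmonic away from `v`.
Sum it by parts against `q`: every tail `u ≠ v` contributes zero, and `v` contributes `-q(v)`, since
the walk is at `v` once and does not come back. -/
theorem walkMean_nodeFlow_tail (e : E) :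
    G.walkMean q G.source (fun x => G.nodeFlow x (G.tail e)) = G.nodeFlow q (G.tail e) := by
  have hn : ∀ v, v ≠ G.sink → 0 < G.nodeFlow q v := fun v => nodeFlow_pos_of_ne_sink hq hpos
  set v := G.tail e with hv
  set h : W → ℝ := fun u => G.walkMean q u (fun x => G.nodeFlow x v)
  have h0 : h G.sink = 0 := by
    simp only [h]; rw [walkMean_sink]; simp [nodeFlow]
  have key := sum_potential_of_mem_flows hq h
  have := Fintype.ofFinite W
  rw [← Finset.sum_fiberwise (s := Finset.univ) (g := G.tail), Finset.sum_eq_single v, h0] at key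
  · have h1 : ∑ a with G.tail a = v, (h (G.head a) - h (G.tail a)) * q a =
        ∑ a with G.tail a = v, - q a := by
      refine Finset.sum_congr rfl fun a ha => ?_
      have ha' : G.tail a = v := by simpa using ha
      have e1 : h (G.head a) = 0 := by
        simp only [h]; rw [← ha']; exact walkMean_nodeFlow_head a
      have e2 : h v = 1 := walkMean_nodeFlow_self hn (G.tail_ne_sink e)
      rw [ha', e1, e2]; ring
    rw [h1, Finset.sum_neg_distrib] at key
    change -G.nodeFlow q v = _ at key
    change h G.source = _
    linarith
  · intro u _ huv
    by_cases hu : u = G.sink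
    · refine Finset.sum_eq_zero fun a ha => ?_
      exact absurd ((by simpa using ha : G.tail a = u).trans hu) (G.tail_ne_sink a)
    · have h1 := walkMean_nodeFlow_step hn hu v
      rw [if_neg huv, zero_add] at h1
      have h2 : ∑ a with G.tail a = u, (h (G.head a) - h (G.tail a)) * q a =
          ∑ a with G.tail a = u, (h (G.head a) - h u) * q a :=
        Finset.sum_congr rfl fun a ha => by rw [(by simpa using ha : G.tail a = u)]
      have h3 : (∑ a with G.tail a = u, q a / G.nodeFlow q u * h (G.head a)) * G.nodeFlow q u =
          ∑ a with G.tail a = u, h (G.head a) * q a := by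
        rw [Finset.sum_mul]
        refine Finset.sum_congr rfl fun a _ => ?_
        have := (hn u hu).ne'
        field_simp
      have h4 : h u = ∑ a with G.tail a = u, q a / G.nodeFlow q u * h (G.head a) := h1
      rw [h2]
      simp only [sub_mul]
      rw [Finset.sum_sub_distrib, ← h3, ← h4, ← Finset.mul_sum]
      change h u * G.nodeFlow q u - h u * G.nodeFlow q u = 0
      ring
  · simp

/-- The traversal of `e` is `q e` times the mean-zero weight plus the fraction `q(e) / q(v)` of the
visits of the tail `v`. -/
theorem walkMean_edge (e : E) : G.walkMean q G.source (fun x => x e) = q e := by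
  have hn : ∀ v, v ≠ G.sink → 0 < G.nodeFlow q v := fun v => nodeFlow_pos_of_ne_sink hq hpos
  have hv := (hn _ (G.tail_ne_sink e)).ne'
  have h1 := walkMean_importance (fun e => (hpos e).ne') hn e G.source
  have he := (hpos e).ne'
  have h2 : (fun x : E → ℝ => x e) = fun x => q e * G.importance q e x +
      q e / G.nodeFlow q (G.tail e) * G.nodeFlow x (G.tail e) := by
    funext x
    rw [importance]
    field_simp
    ring
  rw [h2, walkMean_add, walkMean_const_mul, walkMean_const_mul, h1,
    walkMean_nodeFlow_tail hq hpos]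
  field_simp
  ring

/-- The importance-weighted loss is an unbiased estimator of loss differences between flows. -/
theorem walkMean_loss_sub (ℓ : E → ℝ) {y : E → ℝ} (hy : y ∈ G.flows) :
    G.walkMean q G.source (fun x => (∑ e, ℓ e * x e) * ∑ e, G.importance q e x * y e) =
      ∑ e, ℓ e * y e - G.walkMean q G.source fun x => ∑ e, ℓ e * x e := by
  have hn : ∀ v, v ≠ G.sink → 0 < G.nodeFlow q v := fun v => nodeFlow_pos_of_ne_sink hq hpos
  have h1 : (fun x : E → ℝ => (∑ e, ℓ e * x e) * ∑ e, G.importance q e x * y e) =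
      fun x => ∑ e, y e * ((∑ e, ℓ e * x e) * G.importance q e x) := by
    funext x
    rw [Finset.mul_sum]
    exact Finset.sum_congr rfl fun e _ => by ring
  rw [h1, walkMean_sum]
  have h2 : ∀ e, G.walkMean q G.source
      (fun x => y e * ((∑ e, ℓ e * x e) * G.importance q e x)) =
      -- The visit probability cancels the denominator `q(tail e)`. The remaining bias is a
      -- potential difference, so it telescopes over the unit flow `y`.
      ℓ e * y e + (G.lossToGo q ℓ (G.head e) - G.lossToGo q ℓ (G.tail e)) * y e := by
    intro e
    rw [walkMean_const_mul, walkMean_loss_mul_importance (fun e => (hpos e).ne') hn,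
      walkMean_nodeFlow_tail hq hpos, div_mul_cancel₀ _ (hn _ (G.tail_ne_sink e)).ne']
    ring
  rw [Finset.sum_congr rfl fun e _ => h2 e, Finset.sum_add_distrib,
    sum_potential_of_mem_flows hy (G.lossToGo q ℓ), lossToGo_sink]
  simp only [lossToGo]
  ring

omit [Finite W] [DecidableEq E] in
theorem mul_importance (e : E) (x : E → ℝ) : q e * G.importance q e x =
    x e - G.nodeFlow x (G.tail e) * (q e / G.nodeFlow q (G.tail e)) := by
  have he := (hpos e).ne'
  have hv := (nodeFlow_pos_of_ne_sink hq hpos (G.tail_ne_sink e)).ne'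
  rw [importance]
  field_simp

omit [Finite W] [DecidableEq E] in
-- A path visits the tail zero times or once, and does not use `e` without visiting it, so the visit
-- indicator may be pulled out of the square. This turns the stability term of the log-barrier into
-- exactly `rho`.
theorem sq_mul_importance {x : E → ℝ} (hx : x ∈ G.paths) (e : E) :
    (q e * G.importance q e x) ^ 2 =
      G.nodeFlow x (G.tail e) * (x e - q e / G.nodeFlow q (G.tail e)) ^ 2 := by
  rw [mul_importance hq hpos]
  have := le_nodeFlow (G := G) (fun a => flows_nonneg (paths_subset_flows hx) a) e
  rcases nodeFlow_path hx (G.tail e) with h | h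
  · rcases paths_zero_or_one hx e with h' | h'
    · rw [h, h']; ring
    · rw [h, h'] at this; norm_num at this
  · rw [h]; ring

omit [Finite W] [DecidableEq E] in
-- The bound that lets a barrier of constant weight keep each FTRL step stable.
theorem abs_mul_importance_le_one {x : E → ℝ} (hx : x ∈ G.paths) (e : E) :
    |q e * G.importance q e x| ≤ 1 := by
  have hv := nodeFlow_pos_of_ne_sink hq hpos (G.tail_ne_sink e)
  have h1 : q e / G.nodeFlow q (G.tail e) ≤ 1 :=
    (div_le_one hv).2 (le_nodeFlow (fun a => (hpos a).le) e)
  have h0 : 0 ≤ q e / G.nodeFlow q (G.tail e) := div_nonneg (hpos e).le hv.le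
  rw [mul_importance hq hpos, abs_le]
  rcases nodeFlow_path hx (G.tail e) with h | h <;>
    rcases paths_zero_or_one hx e with h' | h' <;> rw [h, h'] <;> constructor <;> linarith

/-- A Bernoulli variance: on `0/1` paths the square is linear in the traversal of `e` and the visit
of its tail, whose means are known. -/
theorem walkMean_sq_mul_importance (e : E) :
    G.walkMean q G.source (fun x => (q e * G.importance q e x) ^ 2) =
      q e * (1 - q e / G.nodeFlow q (G.tail e)) := by
  have hv := (nodeFlow_pos_of_ne_sink hq hpos (G.tail_ne_sink e)).ne'
  set κ := q e / G.nodeFlow q (G.tail e) with hκ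
  have h1 : ∀ x ∈ G.paths, (q e * G.importance q e x) ^ 2 =
      (1 - 2 * κ) * x e + κ ^ 2 * G.nodeFlow x (G.tail e) := by
    intro x hx
    rw [sq_mul_importance hq hpos hx]
    have := le_nodeFlow (G := G) (fun a => flows_nonneg (paths_subset_flows hx) a) e
    rcases nodeFlow_path hx (G.tail e) with h | h <;>
      rcases paths_zero_or_one hx e with h' | h' <;> rw [h, h'] at this ⊢
    · ring
    · norm_num at this
    · ring
    · ring
  rw [walkMean_congr q h1, walkMean_add, walkMean_const_mul, walkMean_const_mul,
    walkMean_edge hq hpos, walkMean_nodeFlow_tail hq hpos]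
  have h2 : κ * G.nodeFlow q (G.tail e) = q e := div_mul_cancel₀ _ hv
  linear_combination κ * h2

end FlowLaws

end Sampling

end FlowNetwork

/-! ### Regularizers and one-edge stability bounds -/

/-- The combination of a Tsallis entropy of weight `a` and a logarithmic barrier of weights `b`. -/
noncomputable def barrierReg {E : Type*} [Fintype E] (a : ℝ) (b q : E → ℝ) : ℝ :=
  -(2 * a * ∑ e, √(q e)) - ∑ e, b e * Real.log (q e)

theorem tsallisReg_eq_barrierReg {E : Type*} [Fintype E] (t : ℕ) :
    tsallisReg t = barrierReg (E := E) √(t : ℝ) fun _ => 2 := by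
  ext q
  simp [tsallisReg, barrierReg]

theorem logBarrierReg_eq_barrierReg {E : Type*} [Fintype E] (η : E → ℝ) :
    logBarrierReg η = barrierReg 0 fun e => 1 / η e := by
  ext q
  simp [logBarrierReg, barrierReg]

/-- Completing the square in the stability term of the logarithmic barrier. -/
theorem logBarrier_stability {g q y b : ℝ} (hq : 0 < q) (hy : 0 < y) (hb : 2 ≤ b)
    (hg : |q * g| ≤ 1) :
    g * (q - y) - b * (y / q - 1 - Real.log (y / q)) ≤ 2 * (q * g) ^ 2 / b := by
  obtain ⟨z, hz⟩ : ∃ z, z = q * g := ⟨_, rfl⟩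
  obtain ⟨r, hr⟩ : ∃ r, r = y / q := ⟨_, rfl⟩
  have hgr : g * (q - y) = z * (1 - r) := by rw [hz, hr]; field_simp
  have hr0 : 0 < r := hr ▸ div_pos hy hq
  rw [← hz, ← hr, hgr]
  rw [← hz, abs_le] at hg
  have hb0 : 0 < b := by linarith
  have hbz : 0 < b + z := by linarith
  -- The left side is concave in `r` with maximizer `r = b / (b + z)`; this tangent bound on the
  -- logarithm is tight there.
  have h1 := Real.log_le_sub_one_of_pos (show 0 < r * ((b + z) / b) by positivity)
  rw [Real.log_mul hr0.ne' (by positivity)] at h1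
  have h2 := Real.one_sub_inv_le_log_of_pos (show 0 < (b + z) / b by positivity)
  have h3 : b * Real.log r ≤ b * (r * ((b + z) / b) - 1 - (1 - ((b + z) / b)⁻¹)) :=
    mul_le_mul_of_nonneg_left (by linarith) hb0.le
  have h4 : b * (r * ((b + z) / b) - 1 - (1 - ((b + z) / b)⁻¹)) =
      r * (b + z) - b - z + z ^ 2 / (b + z) := by
    field_simp
    ring
  -- `b ≥ 2` and `z ≥ -1` give `b + z ≥ b / 2`.
  have h5 : z ^ 2 / (b + z) ≤ 2 * z ^ 2 / b := by
    rw [div_le_div_iff₀ hbz hb0]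
    nlinarith [sq_nonneg z]
  linarith

/-- The stability term of the Tsallis entropy with an additional logarithmic barrier. -/
theorem tsallis_stability {g q y a : ℝ} (hq : 0 < q) (hy : 0 < y) (ha : 0 < a)
    (hg : |q * g| ≤ 1) :
    g * (q - y) - (a * (√y - √q) ^ 2 / √q + 2 * (y / q - 1 - Real.log (y / q))) ≤
      4 * (q * g) ^ 2 / (a * √q) := by
  obtain ⟨z, hz⟩ : ∃ z, z = q * g := ⟨_, rfl⟩
  obtain ⟨s, hs⟩ : ∃ s, s = √y / √q := ⟨_, rfl⟩
  have hq' : 0 < √q := Real.sqrt_pos.2 hq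
  have hy' : 0 < √y := Real.sqrt_pos.2 hy
  have hs0 : 0 < s := hs ▸ div_pos hy' hq'
  have hr : y / q = s ^ 2 := by
    rw [hs, div_pow, Real.sq_sqrt hq.le, Real.sq_sqrt hy.le]
  obtain ⟨A, hA⟩ : ∃ A, A = a * √q := ⟨_, rfl⟩
  have hA0 : 0 < A := hA ▸ mul_pos ha hq'
  have h1 : a * (√y - √q) ^ 2 / √q = A * (s - 1) ^ 2 := by
    rw [hA, hs]; field_simp
  have h2 : g * (q - y) = z * (1 - s ^ 2) := by rw [hz, ← hr]; field_simp
  rw [h1, h2, hr, ← hz, ← hA, Real.log_pow]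
  rw [← hz] at hg
  have hlog := Real.log_le_sub_one_of_pos hs0
  push_cast
  have hz2 : 0 ≤ z ^ 2 / A := by positivity
  rw [mul_div_assoc]
  obtain ⟨hg1, hg2⟩ := abs_le.1 hg
  -- For `s ≤ 3` the Tsallis divergence absorbs the linear term by completing the square, with `(s +
  -- 1)² / 4 ≤ 4`. For `s ≥ 3` the barrier does it alone: `log s ≤ s - 1` makes its contribution at
  -- least `2 (s - 1)²`, which is at least `s² - 1`.
  rcases le_total s 3 with h3 | h3
  · have h4 : z * (1 - s ^ 2) ≤ A * (s - 1) ^ 2 + (s + 1) ^ 2 / 4 * (z ^ 2 / A) := by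
      have : A * (s - 1) ^ 2 + (s + 1) ^ 2 / 4 * (z ^ 2 / A) - z * (1 - s ^ 2) =
          (A * (s - 1) + (s + 1) / 2 * z) ^ 2 / A := by
        field_simp; ring
      have : 0 ≤ (A * (s - 1) + (s + 1) / 2 * z) ^ 2 / A := by positivity
      linarith
    have h5 : (s + 1) ^ 2 / 4 * (z ^ 2 / A) ≤ 4 * (z ^ 2 / A) :=
      mul_le_mul_of_nonneg_right (by nlinarith) hz2
    nlinarith [sq_nonneg (s - 1)]
  · have h4 : z * (1 - s ^ 2) ≤ s ^ 2 - 1 := by nlinarith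
    have : 0 ≤ A * (s - 1) ^ 2 := by positivity
    nlinarith

/-! ### Follow the regularized leader on the flow polytope -/

namespace FlowNetwork

variable {W E : Type*} {G : FlowNetwork W E} [Fintype E]

/-- At each vertex the traversals of outgoing edges add up to the number of visits, and so do their
conditional expectations. Hence the estimated loss of the current iterate is zero. -/
theorem sum_importance_mul_self [Finite W] [DecidableEq W] {q : E → ℝ} (hq : q ∈ G.flows)
    (hpos : ∀ e, 0 < q e) (x : E → ℝ) : ∑ e, G.importance q e x * q e = 0 := by
  have := Fintype.ofFinite W
  rw [← Finset.sum_fiberwise (s := Finset.univ) (g := G.tail)]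
  refine Finset.sum_eq_zero fun v _ => ?_
  by_cases hv : v = G.sink
  · exact Finset.sum_eq_zero fun e he =>
      absurd ((by simpa using he : G.tail e = v).trans hv) (G.tail_ne_sink e)
  have hn := (nodeFlow_pos_of_ne_sink hq hpos hv)
  have h1 : ∀ e ∈ Finset.univ.filter (fun e => G.tail e = v),
      G.importance q e x * q e = x e - G.nodeFlow x v * (q e / G.nodeFlow q v) := by
    intro e he
    rw [mul_comm, mul_importance hq hpos, (by simpa using he : G.tail e = v)]
  rw [Finset.sum_congr rfl h1, Finset.sum_sub_distrib, ← Finset.mul_sum, sum_div_nodeFlow hn,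
    mul_one]
  exact sub_self _

theorem hasDerivAt_barrier_line (L b q d : E → ℝ) (a : ℝ) (hq : ∀ e, 0 < q e) :
    HasDerivAt (fun s : ℝ => ∑ e, L e * (q e + s * d e) +
        barrierReg a b (fun e => q e + s * d e))
      (∑ e, (L e - a / √(q e) - b e / q e) * d e) 0 := by
  have hline : ∀ e, HasDerivAt (fun s : ℝ => q e + s * d e) (d e) 0 := fun e => by
    simpa using ((hasDerivAt_id (0 : ℝ)).mul_const (d e)).const_add (q e)
  have hne : ∀ e, q e + 0 * d e ≠ 0 := fun e => by simpa using (hq e).ne'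
  have h1 : HasDerivAt (fun s : ℝ => ∑ e, L e * (q e + s * d e)) (∑ e, L e * d e) 0 :=
    HasDerivAt.fun_sum fun e _ => (hline e).const_mul (L e)
  have h2 : HasDerivAt (fun s : ℝ => ∑ e, √(q e + s * d e))
      (∑ e, d e / (2 * √(q e + 0 * d e))) 0 :=
    HasDerivAt.fun_sum fun e _ => (hline e).sqrt (hne e)
  have h3 : HasDerivAt (fun s : ℝ => ∑ e, b e * Real.log (q e + s * d e))
      (∑ e, b e * (d e / (q e + 0 * d e))) 0 :=
    HasDerivAt.fun_sum fun e _ => ((hline e).log (hne e)).const_mul (b e)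
  have h4 := h1.add (((h2.const_mul (2 * a)).neg).sub h3)
  refine h4.congr_deriv ?_
  rw [Finset.mul_sum, ← Finset.sum_neg_distrib, ← Finset.sum_sub_distrib,
    ← Finset.sum_add_distrib]
  refine Finset.sum_congr rfl fun e _ => ?_
  have := (Real.sqrt_pos.2 (hq e)).ne'
  have := (hq e).ne'
  simp only [zero_mul, add_zero]
  field_simp
  ring

/-- The segment from `q` to a positive flow consists of admissible competitors, so the one-sided
derivative of the objective along it is nonnegative. No Lagrange multipliers for the flow
constraints are needed. -/
theorem IsFTRLPoint.first_order {L b q y : E → ℝ} {a : ℝ}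
    (h : G.IsFTRLPoint L (barrierReg a b) q) (hy : y ∈ G.flows) (hypos : ∀ e, 0 < y e) :
    0 ≤ ∑ e, (L e - a / √(q e) - b e / q e) * (y e - q e) := by
  have hd := (hasDerivAt_barrier_line L b q (fun e => y e - q e) a h.2.1).hasDerivWithinAt
    (s := Set.Ioi 0)
  rw [hasDerivWithinAt_iff_tendsto_slope' (by simp)] at hd
  refine ge_of_tendsto hd ?_
  filter_upwards [Ioo_mem_nhdsGT (show (0 : ℝ) < 1 by norm_num)] with s hs
  have hmem : (fun e => q e + s * (y e - q e)) ∈ G.flows := by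
    have := (convex_convexHull ℝ G.paths) h.1 hy (a := 1 - s) (b := s) (by linarith [hs.2])
      hs.1.le (by ring)
    have he : (fun e => q e + s * (y e - q e)) = (1 - s) • q + s • y := by
      funext e
      simp only [Pi.add_apply, Pi.smul_apply, smul_eq_mul]
      ring
    rwa [he]
  have hp : ∀ e, 0 < q e + s * (y e - q e) := fun e => by
    nlinarith [mul_pos hs.1 (hypos e), mul_pos (sub_pos.2 hs.2) (h.2.1 e)]
  have := h.2.2 _ hmem hp
  rw [slope_def_field]
  refine div_nonneg ?_ (by linarith [hs.1])
  simp only [zero_mul, add_zero]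
  linarith

/-- One round of follow the regularized leader, with a bound `st` on the stability term. -/
theorem IsFTRLPoint.step {L b q g st y : E → ℝ} {a : ℝ}
    (h : G.IsFTRLPoint L (barrierReg a b) q) (hg : ∑ e, g e * q e = 0)
    (hst : ∀ e, ∀ r, 0 < r → g e * (q e - r) - (a * (√r - √(q e)) ^ 2 / √(q e) +
      b e * (r / q e - 1 - Real.log (r / q e))) ≤ st e)
    (hy : y ∈ G.flows) (hypos : ∀ e, 0 < y e) :
    ∑ e, L e * q e + barrierReg a b q - ∑ e, st e ≤
      ∑ e, (L e + g e) * y e + barrierReg a b y := by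
  have h1 := h.first_order hy hypos
  -- The terms subtracted in `hst` are the Bregman divergences of the two regularizers; adding them
  -- to the first-order expression turns the linearization into the increment of the regularizer.
  have key : ∑ e, (L e - a / √(q e) - b e / q e) * (y e - q e) -
      ∑ e, (g e * (q e - y e) - (a * (√(y e) - √(q e)) ^ 2 / √(q e) +
      b e * (y e / q e - 1 - Real.log (y e / q e)))) =
      ∑ e, (L e * y e - L e * q e - (g e * q e - g e * y e) -
        (2 * a * √(y e) - 2 * a * √(q e)) -
        (b e * Real.log (y e) - b e * Real.log (q e))) := by
    rw [← Finset.sum_sub_distrib]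
    refine Finset.sum_congr rfl fun e _ => ?_
    have hq := h.2.1 e
    have hs := (Real.sqrt_pos.2 hq).ne'
    rw [Real.log_div (hypos e).ne' hq.ne']
    have e1 : (√(q e)) ^ 2 = q e := Real.sq_sqrt hq.le
    have e2 : (√(y e)) ^ 2 = y e := Real.sq_sqrt (hypos e).le
    have e3 : a * (√(y e) - √(q e)) ^ 2 / √(q e) =
        a / √(q e) * (y e - q e) - 2 * a * √(y e) + 2 * a * √(q e) := by
      rw [← e1, ← e2, Real.sqrt_sq (Real.sqrt_nonneg _), Real.sqrt_sq (Real.sqrt_nonneg _)]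
      field_simp
      ring
    have e4 : b e / q e * (y e - q e) = b e * (y e / q e - 1) := by field_simp
    rw [e3]
    linear_combination -e4
  have h2 : ∑ e, (g e * (q e - y e) - (a * (√(y e) - √(q e)) ^ 2 / √(q e) +
      b e * (y e / q e - 1 - Real.log (y e / q e)))) ≤ ∑ e, st e :=
    Finset.sum_le_sum fun e _ => hst e _ (hypos e)
  have h3 : 0 - ∑ e, st e ≤ ∑ e, (L e * y e - L e * q e - (g e * q e - g e * y e) -
        (2 * a * √(y e) - 2 * a * √(q e)) -
        (b e * Real.log (y e) - b e * Real.log (q e))) := by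
    rw [← key]
    exact sub_le_sub h1 h2
  simp only [Finset.sum_sub_distrib, ← Finset.mul_sum] at h3
  simp only [barrierReg, add_mul, Finset.sum_add_distrib]
  linarith

/-- The regret bound for follow the regularized leader. -/
theorem ftrl_regret {T : ℕ} {q g : ℕ → E → ℝ} {ψ : ℕ → (E → ℝ) → ℝ} {st : ℕ → ℝ}
    (hq : ∀ t ∈ Finset.Icc 1 T, q t ∈ G.flows ∧ ∀ e, 0 < q t e)
    (hstep : ∀ t ∈ Finset.Icc 1 T, ∀ y ∈ G.flows, (∀ e, 0 < y e) →
      ∑ e, (∑ τ ∈ Finset.Ico 1 t, g τ e) * q t e + ψ t (q t) - st t ≤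
        ∑ e, (∑ τ ∈ Finset.Ico 1 t, g τ e + g t e) * y e + ψ t y)
    (hT : 1 ≤ T) {y : E → ℝ} (hy : y ∈ G.flows) (hypos : ∀ e, 0 < y e) :
    -∑ t ∈ Finset.Icc 1 T, ∑ e, g t e * y e ≤ ψ T y - ψ 1 (q 1) +
      ∑ t ∈ Finset.Ico 1 T, (ψ t (q (t + 1)) - ψ (t + 1) (q (t + 1))) +
      ∑ t ∈ Finset.Icc 1 T, st t := by
  -- The claim is for all comparators at once, because the induction step applies round `k` to the
  -- next iterate `q (k + 1)`. The regularizer changes only between rounds, so the last one is `ψ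
  -- T`.
  have key : ∀ k, 1 ≤ k → k ≤ T → ∀ y ∈ G.flows, (∀ e, 0 < y e) →
      ψ 1 (q 1) - ∑ t ∈ Finset.Ico 1 k, (ψ t (q (t + 1)) - ψ (t + 1) (q (t + 1))) -
        ∑ t ∈ Finset.Ico 1 (k + 1), st t ≤
      ∑ e, (∑ τ ∈ Finset.Ico 1 (k + 1), g τ e) * y e + ψ k y := by
    intro k hk
    induction k, hk using Nat.le_induction with
    | base =>
      intro hT y hy hypos
      have := hstep 1 (by simp [hT]) y hy hypos
      simpa using this
    | succ k hk ih =>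
      intro hkT y hy hypos
      have hmem : k + 1 ∈ Finset.Icc 1 T := by simp [hkT]
      have h1 := hstep (k + 1) hmem y hy hypos
      have h2 := ih (by omega) (q (k + 1)) (hq _ hmem).1 (hq _ hmem).2
      rw [Finset.sum_Ico_succ_top (by omega : 1 ≤ k),
        Finset.sum_Ico_succ_top (by omega : 1 ≤ k + 1)]
      simp only [fun e => Finset.sum_Ico_succ_top (by omega : 1 ≤ k + 1) (fun τ => g τ e)]
      linarith
  have h := key T hT le_rfl y hy hypos
  have h4 : Finset.Ico 1 (T + 1) = Finset.Icc 1 T := by ext; simp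
  have h3 : ∑ e, (∑ τ ∈ Finset.Ico 1 (T + 1), g τ e) * y e =
      ∑ t ∈ Finset.Icc 1 T, ∑ e, g t e * y e := by
    rw [Finset.sum_comm]
    exact Finset.sum_congr rfl fun e _ => by rw [Finset.sum_mul, h4]
  rw [h3, h4] at h
  linarith

/-- The iterates stay away from the boundary. -/
theorem IsFTRLPoint.exp_neg_le [Nonempty E] {L b q : E → ℝ} {a A B K : ℝ}
    (h : G.IsFTRLPoint L (barrierReg a b) q) (hL : ∀ e, |L e| ≤ B) (ha : 0 ≤ a) (haA : a ≤ A)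
    (hb : ∀ e, 2 ≤ b e) (hbK : ∀ e, b e ≤ K) (e : E) :
    Real.exp (-(Fintype.card E * (2 * B + 2 * A + K * Real.log (Fintype.card E)))) ≤ q e := by
  obtain ⟨y, hy, hy1⟩ := exists_spread_flow G
  have hm : (0 : ℝ) < Fintype.card E := by exact_mod_cast Fintype.card_pos
  have hypos : ∀ e, 0 < y e := fun e => lt_of_lt_of_le (by positivity) (hy1 e)
  have hB : 0 ≤ B := (abs_nonneg _).trans (hL e)
  -- The spread flow has objective at most a fixed bound. As every `-b log q` is nonnegative and `b
  -- ≥ 2`, a single `-log (q e)` is controlled by the whole barrier.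
  have hle := h.2.2 y hy hypos
  have hlog : ∀ e, Real.log (q e) ≤ 0 := fun e =>
    Real.log_nonpos (h.2.1 e).le (flows_le_one h.1 e)
  have h1 : -Real.log (q e) ≤ ∑ e, -(b e * Real.log (q e)) := by
    refine le_trans ?_ (Finset.single_le_sum (f := fun e => -(b e * Real.log (q e)))
      (fun e _ => ?_) (Finset.mem_univ e))
    · nlinarith [hlog e, hb e]
    · nlinarith [hlog e, hb e]
  have hbd : ∀ x ∈ G.flows, |∑ e, L e * x e| ≤ Fintype.card E * B := by
    intro x hx
    refine (Finset.abs_sum_le_sum_abs _ _).trans ?_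
    refine (Finset.sum_le_card_nsmul _ _ B fun e _ => ?_).trans (by simp)
    rw [abs_mul, abs_of_nonneg (flows_nonneg hx e)]
    nlinarith [hL e, flows_le_one hx e, abs_nonneg (L e), flows_nonneg hx e]
  have h2 : ∑ e, -(b e * Real.log (y e)) ≤ Fintype.card E * (K * Real.log (Fintype.card E)) := by
    refine (Finset.sum_le_card_nsmul _ _ (K * Real.log (Fintype.card E)) fun e _ => ?_).trans
      (by simp)
    have h3 := Real.log_le_log (by positivity) (hy1 e)
    rw [Real.log_div one_ne_zero hm.ne', Real.log_one, zero_sub] at h3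
    have h4 : 0 ≤ Real.log (Fintype.card E) := Real.log_natCast_nonneg _
    nlinarith [hb e, hbK e]
  have h5 : ∑ e, √(q e) ≤ Fintype.card E := by
    refine (Finset.sum_le_card_nsmul _ _ 1 fun e _ => ?_).trans (by simp)
    exact Real.sqrt_le_one.2 (flows_le_one h.1 e)
  have h6 : 0 ≤ ∑ e, √(y e) := Finset.sum_nonneg fun e _ => Real.sqrt_nonneg _
  have h7 := abs_le.1 (hbd y hy)
  have h8 := abs_le.1 (hbd q h.1)
  rw [Finset.sum_neg_distrib] at h1 h2
  simp only [barrierReg] at hle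
  have h9 : a * ∑ e, √(q e) ≤ A * Fintype.card E :=
    mul_le_mul haA h5 (Finset.sum_nonneg fun e _ => Real.sqrt_nonneg _) (ha.trans haA)
  have h10 : 0 ≤ a * ∑ e, √(y e) := mul_nonneg ha h6
  rw [← Real.le_log_iff_exp_le (h.2.1 e)]
  nlinarith

end FlowNetwork

/-! ### Scalar sums over the rounds -/

/-- The sum of the self-normalized increments is controlled by the root of the total. -/
theorem sum_div_sqrt_le {ρ : ℕ → ℝ} {L : ℝ} (hL : 1 / 2 ≤ L) (T : ℕ)
    (h0 : ∀ t ∈ Finset.Ico 1 T, 0 ≤ ρ t) (h1 : ∀ t ∈ Finset.Ico 1 T, ρ t ≤ 1) :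
    ∑ t ∈ Finset.Ico 1 T, ρ t / √(4 + 1 / L * ∑ τ ∈ Finset.Ico 1 t, ρ τ) ≤
      2 * √((∑ t ∈ Finset.Ico 1 T, ρ t) * L) := by
  induction T with
  | zero => simp
  | succ k ih =>
    rcases Nat.eq_zero_or_pos k with rfl | hk
    · simp
    rw [Finset.sum_Ico_succ_top hk, Finset.sum_Ico_succ_top hk]
    have hsub : ∀ t ∈ Finset.Ico 1 k, t ∈ Finset.Ico 1 (k + 1) := fun t ht => by
      simp at ht ⊢; omega
    have ih' := ih (fun t ht => h0 t (hsub t ht)) fun t ht => h1 t (hsub t ht)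
    have hρ := h1 k (by simp; omega)
    have hρ0 := h0 k (by simp; omega)
    obtain ⟨S, hS⟩ : ∃ S, S = ∑ t ∈ Finset.Ico 1 k, ρ t := ⟨_, rfl⟩
    have hS0 : 0 ≤ S := hS ▸ Finset.sum_nonneg fun t ht => h0 t (hsub t ht)
    rw [← hS] at ih' ⊢
    have hL0 : 0 < L := by linarith
    refine (add_le_add_left ih' _).trans ?_
    rcases hρ0.eq_or_lt with h | h
    · simp [← h]
    have hA : √(S * L) ^ 2 = S * L := Real.sq_sqrt (by positivity)
    have hB : √((S + ρ k) * L) ^ 2 = (S + ρ k) * L := Real.sq_sqrt (by positivity)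
    have hA0 : 0 ≤ √(S * L) := Real.sqrt_nonneg _
    have hB0 : 0 < √((S + ρ k) * L) := Real.sqrt_pos.2 (by positivity)
    -- The normalization does not yet contain `ρ k`; the offset 4 makes up for it, since `ρ k ≤ 1 ≤
    -- 4 L`.
    have hD : √((S + ρ k) * L) ≤ L * √(4 + 1 / L * S) := by
      rw [← Real.sqrt_sq hL0.le, ← Real.sqrt_mul (by positivity), Real.sqrt_sq hL0.le]
      refine Real.sqrt_le_sqrt ?_
      have : L ^ 2 * (4 + 1 / L * S) = 4 * L ^ 2 + L * S := by field_simp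
      rw [this]
      nlinarith
    have hD0 : 0 < √(4 + 1 / L * S) := Real.sqrt_pos.2 (by positivity)
    have hAB : √(S * L) ≤ √((S + ρ k) * L) := Real.sqrt_le_sqrt (by nlinarith)
    have key : ρ k / √(4 + 1 / L * S) ≤ 2 * (√((S + ρ k) * L) - √(S * L)) := by
      rw [div_le_iff₀ hD0]
      have h2 : (√((S + ρ k) * L) - √(S * L)) * (√((S + ρ k) * L) + √(S * L)) = ρ k * L := by
        linear_combination hB - hA
      have h3 : ρ k * L ≤ (√((S + ρ k) * L) - √(S * L)) * (2 * √((S + ρ k) * L)) := by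
        rw [← h2]
        exact mul_le_mul_of_nonneg_left (by linarith) (by linarith)
      have h4 : (√((S + ρ k) * L) - √(S * L)) * (2 * √((S + ρ k) * L)) ≤
          (√((S + ρ k) * L) - √(S * L)) * (2 * (L * √(4 + 1 / L * S))) :=
        mul_le_mul_of_nonneg_left (by linarith) (by linarith)
      have h5 : ρ k * L ≤ 2 * (√((S + ρ k) * L) - √(S * L)) * √(4 + 1 / L * S) * L := by
        linarith
      exact le_of_mul_le_mul_right h5 hL0
    linarith

theorem sqrt_succ_sub_sqrt_le (k : ℕ) :
    √((k + 1 : ℕ) : ℝ) - √(k : ℝ) ≤ 1 / √((k + 1 : ℕ) : ℝ) := by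
  have h1 : 0 < √((k + 1 : ℕ) : ℝ) := Real.sqrt_pos.2 (by positivity)
  have h2 := Real.sqrt_nonneg (k : ℝ)
  have h3 : √((k + 1 : ℕ) : ℝ) ^ 2 = k + 1 := by rw [Real.sq_sqrt (by positivity)]; push_cast; rfl
  have h4 : √(k : ℝ) ^ 2 = k := Real.sq_sqrt (by positivity)
  have h5 : √(k : ℝ) ≤ √((k + 1 : ℕ) : ℝ) := Real.sqrt_le_sqrt (by push_cast; linarith)
  rw [le_div_iff₀ h1]
  nlinarith

/-- The penalty of the Tsallis entropy with weights `√t`. -/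
theorem sum_sqrt_penalty_le {Q X : ℕ → ℝ} {U ε : ℝ} (T : ℕ) (hT : 1 ≤ T) (hX : ∀ t, 0 ≤ X t)
    (h : ∀ t ∈ Finset.Icc 1 T, Q t ≤ U + X t + ε) :
    2 * Q 1 + ∑ t ∈ Finset.Ico 1 T, 2 * (√((t + 1 : ℕ) : ℝ) - √(t : ℝ)) * Q (t + 1) -
      2 * √(T : ℝ) * U ≤ ∑ t ∈ Finset.Icc 1 T, 2 / √(t : ℝ) * X t + 2 * √(T : ℝ) * ε := by
  induction T, hT using Nat.le_induction with
  | base =>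
    have := h 1 (by simp)
    simp
    linarith
  | succ k hk ih =>
    have ih' := ih fun t ht => h t (by simp at ht ⊢; omega)
    rw [Finset.sum_Ico_succ_top hk, Finset.sum_Icc_succ_top (by omega)]
    have h1 := h (k + 1) (by simp)
    have h2 := sqrt_succ_sub_sqrt_le k
    have h3 : √(k : ℝ) ≤ √((k + 1 : ℕ) : ℝ) := Real.sqrt_le_sqrt (by push_cast; linarith)
    -- The coefficients telescope to `√T`, so the `U` parts cancel exactly and the `ε` parts add up
    -- to `2 √T ε`. Only the `X` part needs the bound `1 / √(k + 1)` on the coefficient.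
    have h4 : (√((k + 1 : ℕ) : ℝ) - √(k : ℝ)) * Q (k + 1) ≤
        (√((k + 1 : ℕ) : ℝ) - √(k : ℝ)) * (U + X (k + 1) + ε) :=
      mul_le_mul_of_nonneg_left h1 (by linarith)
    have h5 : (√((k + 1 : ℕ) : ℝ) - √(k : ℝ)) * X (k + 1) ≤ 1 / √((k + 1 : ℕ) : ℝ) * X (k + 1) :=
      mul_le_mul_of_nonneg_right h2 (hX _)
    have h6 : 2 / √((k + 1 : ℕ) : ℝ) * X (k + 1) = 2 * (1 / √((k + 1 : ℕ) : ℝ) * X (k + 1)) := by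
      ring
    rw [h6]
    linarith

theorem half_le_log {T : ℕ} (hT : 2 ≤ T) : 1 / 2 ≤ Real.log T := by
  have h1 : Real.log 2 ≤ Real.log T := Real.log_le_log (by norm_num) (by exact_mod_cast hT)
  linarith [Real.log_two_gt_d9]

/-! ### The comparator and the flow off the path -/

namespace FlowNetwork

variable {W E : Type*} {G : FlowNetwork W E} [Fintype E]

/-- A flow close to a given path that is not too small on any edge. -/
theorem exists_mixed_flow {T : ℕ} (hT : 2 ≤ T) (hm : Fintype.card E ≤ T) {x : E → ℝ}
    (hx : x ∈ G.paths) : ∃ u ∈ G.flows, (∀ e, 0 < u e) ∧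
      (∀ e, -Real.log (u e) ≤ 2 * Real.log T) ∧
      (∀ e, x e = 1 → 1 - 1 / (T : ℝ) ≤ u e) ∧
      ∀ ℓ : E → ℝ, (∀ e, 0 ≤ ℓ e) → (∀ z ∈ G.paths, ∑ e, ℓ e * z e ≤ 1) →
        ∑ e, ℓ e * (u e - x e) ≤ 1 / T := by
  have hE : Nonempty E := by
    obtain ⟨l, hl, -⟩ := hx
    cases l with
    | nil => exact absurd hl G.source_ne_sink
    | cons a l => exact ⟨a⟩
  obtain ⟨y, hy, hy1⟩ := exists_spread_flow G
  have hm0 : (0 : ℝ) < Fintype.card E := by exact_mod_cast Fintype.card_pos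
  have hT0 : (0 : ℝ) < T := by exact_mod_cast (by omega : 0 < T)
  have hT1 : 1 / (T : ℝ) ≤ 1 := by
    rw [div_le_one hT0]; exact_mod_cast (by omega : 1 ≤ T)
  have hmT : (Fintype.card E : ℝ) ≤ T := by exact_mod_cast hm
  have hx0 : ∀ e, 0 ≤ x e := flows_nonneg (paths_subset_flows hx)
  -- The spread flow has mass at least `1/m ≥ 1/T` and enters with weight `1/T`; this gives the
  -- factor 2 in front of `log T`.
  have hlow : ∀ e, 1 / (T : ℝ) ^ 2 ≤ (1 - 1 / (T : ℝ)) * x e + 1 / T * y e := fun e => by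
    have h1 : 1 / (T : ℝ) ≤ y e := (one_div_le_one_div_of_le hm0 hmT).trans (hy1 e)
    have h2 : 1 / (T : ℝ) ^ 2 = 1 / T * (1 / T) := by field_simp
    have h3 : 0 ≤ (1 - 1 / (T : ℝ)) * x e := mul_nonneg (by linarith) (hx0 e)
    have h4 : 1 / (T : ℝ) * (1 / T) ≤ 1 / T * y e := mul_le_mul_of_nonneg_left h1 (by positivity)
    linarith
  refine ⟨fun e => (1 - 1 / (T : ℝ)) * x e + 1 / T * y e, ?_, ?_, ?_, ?_, ?_⟩
  · have := (convex_convexHull ℝ G.paths) (paths_subset_flows hx) hy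
      (a := 1 - 1 / (T : ℝ)) (b := 1 / T) (by linarith) (by positivity) (by ring)
    exact this
  · exact fun e => lt_of_lt_of_le (by positivity) (hlow e)
  · intro e
    have := Real.log_le_log (by positivity) (hlow e)
    rw [Real.log_div one_ne_zero (by positivity), Real.log_one, Real.log_pow] at this
    push_cast at this
    linarith
  · intro e he
    have h1 : 0 ≤ 1 / (T : ℝ) * y e := mul_nonneg (by positivity) (flows_nonneg hy e)
    simp only [he]
    linarith
  · intro ℓ h0 h1
    have h2 := sum_le_of_mem_flows h1 hy
    have h3 : 0 ≤ ∑ e, ℓ e * x e := Finset.sum_nonneg fun e _ => mul_nonneg (h0 e) (hx0 e)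
    have h4 : ∑ e, ℓ e * ((1 - 1 / (T : ℝ)) * x e + 1 / T * y e - x e) =
        1 / T * (∑ e, ℓ e * y e - ∑ e, ℓ e * x e) := by
      rw [← Finset.sum_sub_distrib, Finset.mul_sum]
      exact Finset.sum_congr rfl fun e _ => by ring
    rw [h4]
    calc 1 / (T : ℝ) * (∑ e, ℓ e * y e - ∑ e, ℓ e * x e) ≤ 1 / T * 1 :=
          mul_le_mul_of_nonneg_left (by linarith) (by positivity)
      _ = 1 / T := mul_one _

theorem loss_le_one {ℓ : E → ℝ} (h0 : ∀ e, 0 ≤ ℓ e)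
    (h1 : ∀ z ∈ G.paths, ∑ e, ℓ e * z e ≤ 1) (e : E) : ℓ e ≤ 1 := by
  obtain ⟨l, hl, he⟩ := exists_isWalk_source_sink_mem (G := G) e
  have h2 := Finset.single_le_sum (f := fun a => ℓ a * edgeVec l a) (fun a _ =>
    mul_nonneg (h0 a) (flows_nonneg (paths_subset_flows ⟨l, hl, rfl⟩) a)) (Finset.mem_univ e)
  simp only [edgeVec_of_mem he, mul_one] at h2
  exact h2.trans (h1 _ ⟨l, hl, rfl⟩)

variable [Fintype W] [DecidableEq W]

theorem sum_sum_tail (F : W → E → ℝ) :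
    ∑ v with v ≠ G.sink, ∑ e with G.tail e = v, F v e = ∑ e, F (G.tail e) e := by
  rw [← Finset.sum_fiberwise_of_maps_to (s := Finset.univ)
    (t := Finset.univ.filter fun v => v ≠ G.sink) (g := G.tail)
    (fun e _ => by simpa using G.tail_ne_sink e)]
  exact Finset.sum_congr rfl fun v _ => Finset.sum_congr rfl fun e he => by
    rw [(by simpa using he : G.tail e = v)]

variable [DecidableEq E]

/-- The roots of the flow on the edges that a selection of edges avoids, together with those of the
selected edges off the path `x`. -/
noncomputable def offPathRoot (G : FlowNetwork W E) (x : E → ℝ) (π : W → E) (q : E → ℝ) : ℝ :=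
  (∑ v with v ≠ G.sink, ∑ e with G.tail e = v ∧ e ≠ π v, √(q e)) +
    ∑ v with v ≠ G.source ∧ v ≠ G.sink ∧ G.nodeFlow x v ≠ 1, √(q (π v))

theorem offPathRoot_nonneg (x : E → ℝ) (π : W → E) (q : E → ℝ) : 0 ≤ G.offPathRoot x π q :=
  add_nonneg (Finset.sum_nonneg fun _ _ => Finset.sum_nonneg fun _ _ => Real.sqrt_nonneg _)
    (Finset.sum_nonneg fun _ _ => Real.sqrt_nonneg _)

/-- The edges off the path are avoided by the selection, or selected at a vertex off the path. -/
theorem sum_sqrt_off_path_le {x : E → ℝ} (hx : x ∈ G.paths) {π : W → E}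
    (hπ : G.Consistent x π) (q : E → ℝ) :
    ∑ e, (if x e = 1 then 0 else √(q e)) ≤ G.offPathRoot x π q := by
  rw [← sum_sum_tail (G := G) fun v e => if x e = 1 then 0 else √(q e), offPathRoot]
  have h2 : ∑ v with v ≠ G.source ∧ v ≠ G.sink ∧ G.nodeFlow x v ≠ 1, √(q (π v)) =
      ∑ v with v ≠ G.sink, if G.nodeFlow x v ≠ 1 then √(q (π v)) else 0 := by
    rw [← Finset.sum_filter, Finset.filter_filter]
    refine Finset.sum_congr (Finset.filter_congr fun v _ => ?_) fun _ _ => rfl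
    constructor
    · exact fun h => h.2
    · refine fun h => ⟨?_, h⟩
      rintro rfl
      exact h.2 (nodeFlow_source_path hx)
  rw [h2, ← Finset.sum_add_distrib]
  refine Finset.sum_le_sum fun v hv => ?_
  have hv' : v ≠ G.sink := by simpa using hv
  rw [← Finset.filter_filter, Finset.sum_filter (p := fun e => e ≠ π v)]
  have hπv : π v ∈ Finset.univ.filter fun e => G.tail e = v := by simpa using hπ.1 v hv'
  have h3 : (if G.nodeFlow x v ≠ 1 then √(q (π v)) else 0) = ∑ e with G.tail e = v,
      if e = π v then (if G.nodeFlow x v ≠ 1 then √(q (π v)) else 0) else 0 := by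
    rw [Finset.sum_ite_eq', if_pos hπv]
  rw [h3, ← Finset.sum_add_distrib]
  refine Finset.sum_le_sum fun e he => ?_
  have he' : G.tail e = v := by simpa using he
  have hs := Real.sqrt_nonneg (q e)
  -- A selected edge at a vertex of `x` belongs to `x` by consistency and costs nothing; at a vertex
  -- off `x` the second sum pays for it.
  by_cases h : e = π v
  · by_cases h1 : G.nodeFlow x v = 1
    · obtain ⟨a, ha, hxa⟩ := exists_of_nodeFlow_eq_one hx h1
      have := hπ.2 a hxa
      rw [ha, ← h] at this
      subst this
      simp [h1, h.symm, hxa]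
    · simp [← h, h1]
      split_ifs <;> simp [hs]
  · simp [h]
    split_ifs <;> simp [hs]

/-- The variance of the estimator is governed by the edges that a selection avoids. -/
theorem sum_sqrt_mul_one_sub_le {π : W → E} (hπ : ∀ v, v ≠ G.sink → G.tail (π v) = v)
    {q : E → ℝ} (hq : q ∈ G.flows) (hpos : ∀ e, 0 < q e) :
    ∑ e, √(q e) * (1 - q e / G.nodeFlow q (G.tail e)) ≤
      2 * ∑ v with v ≠ G.sink, ∑ e with G.tail e = v ∧ e ≠ π v, √(q e) := by
  rw [← sum_sum_tail (G := G) fun v e => √(q e) * (1 - q e / G.nodeFlow q v), Finset.mul_sum]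
  refine Finset.sum_le_sum fun v hv => ?_
  have hv' : v ≠ G.sink := by simpa using hv
  have hn := nodeFlow_pos_of_ne_sink hq hpos hv'
  have hπv : π v ∈ Finset.univ.filter fun e => G.tail e = v := by simpa using hπ v hv'
  have hset : (Finset.univ.filter fun e => G.tail e = v ∧ e ≠ π v) =
      (Finset.univ.filter fun e => G.tail e = v).erase (π v) := by
    ext e; simp [and_comm]
  rw [hset, ← Finset.add_sum_erase _ _ hπv, two_mul]
  have h1 := sum_div_nodeFlow hn
  rw [← Finset.add_sum_erase _ _ hπv] at h1
  refine add_le_add ?_ (Finset.sum_le_sum fun e _ => ?_)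
  · rw [show 1 - q (π v) / G.nodeFlow q v = ∑ e ∈ (Finset.univ.filter fun e =>
      G.tail e = v).erase (π v), q e / G.nodeFlow q v by linarith, Finset.mul_sum]
    refine Finset.sum_le_sum fun e he => ?_
    have hev : G.tail e = v := by
      have := Finset.mem_of_mem_erase he
      simpa using this
    have hle : q e ≤ G.nodeFlow q v := hev ▸ le_nodeFlow (fun a => (hpos a).le) e
    have hle' : q (π v) ≤ G.nodeFlow q v := by
      have := le_nodeFlow (G := G) (fun a => (hpos a).le) (π v)
      rwa [hπ v hv'] at this
    have e1 : √(q e) * √(q e) = q e := Real.mul_self_sqrt (hpos e).le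
    have e2 : √(G.nodeFlow q v) * √(G.nodeFlow q v) = G.nodeFlow q v :=
      Real.mul_self_sqrt hn.le
    have hs := Real.sqrt_nonneg (q e)
    have h3 := mul_le_mul (Real.sqrt_le_sqrt hle') (Real.sqrt_le_sqrt hle) hs
      (Real.sqrt_nonneg _)
    rw [mul_div_assoc', div_le_iff₀ hn]
    calc √(q (π v)) * q e = √(q e) * (√(q (π v)) * √(q e)) := by linear_combination -√(q (π v)) * e1
      _ ≤ √(q e) * G.nodeFlow q v := mul_le_mul_of_nonneg_left (h3.trans e2.le) hs
  · have : 0 ≤ q e / G.nodeFlow q v := div_nonneg (hpos e).le hn.le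
    nlinarith [Real.sqrt_nonneg (q e)]

/-- The flow on a selected edge off the path is at most that through its tail, hence at most the
total flow leaving the path. There are at most `n` such edges. -/
theorem offPathRoot_le {x : E → ℝ} (hx : x ∈ G.paths) {π : W → E} (hπ : G.Consistent x π)
    {q : E → ℝ} (hq : q ∈ G.flows) :
    G.offPathRoot x π q ≤ (∑ v with v ≠ G.sink, ∑ e with G.tail e = v ∧ e ≠ π v, √(q e)) +
      (Finset.card {v : W | v ≠ G.source ∧ v ≠ G.sink} : ℝ) *
        √(∑ v with v = G.source ∨ (v ≠ G.sink ∧ G.nodeFlow x v = 1),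
          ∑ e with G.tail e = v ∧ e ≠ π v, q e) := by
  refine add_le_add le_rfl ?_
  refine (Finset.sum_le_card_nsmul _ _ (√(∑ v with v = G.source ∨ (v ≠ G.sink ∧
    G.nodeFlow x v = 1), ∑ e with G.tail e = v ∧ e ≠ π v, q e))
    fun v hv => Real.sqrt_le_sqrt ?_).trans ?_
  · simp only [Finset.mem_filter] at hv
    refine le_trans ?_ (nodeFlow_le_sum_leaving hx hπ hv.2.2.2 hq)
    have := le_nodeFlow (G := G) (flows_nonneg hq) (π v)
    rwa [hπ.1 v hv.2.2.1] at this
  · rw [nsmul_eq_mul]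
    refine mul_le_mul_of_nonneg_right ?_ (Real.sqrt_nonneg _)
    exact_mod_cast Finset.card_le_card fun v hv => by
      simp only [Finset.mem_filter] at hv ⊢
      exact ⟨hv.1, hv.2.1, hv.2.2.1⟩

end FlowNetwork

/-! ### Conditional expectations in the protocol -/

namespace BanditRun

variable {W E Ω : Type*} [Fintype E] [DecidableEq W] [mΩ : MeasurableSpace Ω]
  {G : FlowNetwork W E} {T : ℕ} {μ : Measure Ω} (R : BanditRun G T μ)

theorem integrable_of_abs_le [IsFiniteMeasure μ] {f : Ω → ℝ} (hf : Measurable f) {K : ℝ}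
    (hK : ∀ ω, |f ω| ≤ K) : Integrable f μ :=
  Integrable.of_bound hf.aestronglyMeasurable K (Filter.Eventually.of_forall hK)

section Measurability

variable {t : ℕ} (ht : t ∈ Finset.Icc 1 T)
include ht

theorem measurable_loss : Measurable (R.ℓ t) := (R.measurable_ℓ t ht).mono (R.ℱ.le t) le_rfl

theorem measurable_flow : Measurable (R.q t) := (R.measurable_q t ht).mono (R.ℱ.le t) le_rfl

theorem measurable_path : Measurable (R.p t) :=
  (R.measurable_p t ht).mono (R.ℱ.le (t + 1)) le_rfl

theorem measurable_feedback : Measurable (R.c t) :=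
  (R.measurable_c t ht).mono (R.ℱ.le (t + 1)) le_rfl

end Measurability

theorem measurable_nodeFlow (v : W) : Measurable fun x : E → ℝ => G.nodeFlow x v :=
  Finset.measurable_sum _ fun e _ => measurable_pi_apply e

theorem measurable_importance (e : E) :
    Measurable fun z : (E → ℝ) × (E → ℝ) => G.importance z.1 e z.2 := by
  unfold FlowNetwork.importance
  have h1 : Measurable fun z : (E → ℝ) × (E → ℝ) => G.nodeFlow z.1 (G.tail e) :=
    (measurable_nodeFlow _).comp measurable_fst
  have h2 : Measurable fun z : (E → ℝ) × (E → ℝ) => G.nodeFlow z.2 (G.tail e) :=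
    (measurable_nodeFlow _).comp measurable_snd
  have h3 : Measurable fun z : (E → ℝ) × (E → ℝ) => z.1 e :=
    (measurable_pi_apply e).comp measurable_fst
  have h4 : Measurable fun z : (E → ℝ) × (E → ℝ) => z.2 e :=
    (measurable_pi_apply e).comp measurable_snd
  exact (h4.div h3).sub (h2.div h1)

section Expectation

variable {t : ℕ} (ht : t ∈ Finset.Icc 1 T)
include ht

/-- The expectation of a function of the past and of the sampled path. -/
theorem integral_path [IsProbabilityMeasure μ] (Φ : (E → ℝ) → Ω → ℝ) (K : ℝ)
    (hΦ : ∀ x ∈ G.paths, Measurable[R.ℱ t] (Φ x)) (hK : ∀ x ∈ G.paths, ∀ ω, |Φ x ω| ≤ K) :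
    ∫ ω, Φ (R.p t ω) ω ∂μ = ∫ ω, G.walkMean (R.q t ω) G.source (fun x => Φ x ω) ∂μ := by
  classical
  have hle := R.ℱ.le t
  have hmeas : ∀ x, MeasurableSet {ω | R.p t ω = x} := fun x =>
    R.measurable_path ht (measurableSet_singleton x)
  -- The path takes finitely many values, so the integrand is a finite sum of `Φ x * I x`. As `Φ x`
  -- is known from the past, conditioning replaces the indicator by the path probability.
  set I : (E → ℝ) → Ω → ℝ := fun x => Set.indicator {ω | R.p t ω = x} fun _ => 1
  have hI : ∀ x, Integrable (I x) μ := fun x => (integrable_const 1).indicator (hmeas x)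
  have hce : ∀ x ∈ G.paths, μ[Φ x * I x | R.ℱ t] =ᵐ[μ] fun ω => G.pathProb (R.q t ω) x * Φ x ω := by
    intro x hx
    have h1 := condExp_stronglyMeasurable_mul_of_bound hle (hΦ x hx).stronglyMeasurable (hI x) K
      (Filter.Eventually.of_forall (hK x hx))
    filter_upwards [h1, R.p_law t ht x hx] with ω h2 h3
    rw [h2, Pi.mul_apply, h3, mul_comm]
  have hint : ∀ x ∈ G.paths, Integrable (Φ x * I x) μ := fun x hx =>
    (hI x).bdd_mul ((hΦ x hx).mono hle le_rfl).aestronglyMeasurable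
      (Filter.Eventually.of_forall (hK x hx))
  have h1 : ∀ ω, Φ (R.p t ω) ω = ∑ x ∈ G.pathFinset, (Φ x * I x) ω := by
    intro ω
    rw [Finset.sum_eq_single (R.p t ω)]
    · simp [I]
    · intro x _ hx
      simp [I, Ne.symm hx]
    · exact fun h => absurd (FlowNetwork.mem_pathFinset.2 (R.p_mem t ht ω)) h
  simp_rw [h1, ← FlowNetwork.sum_pathProb_mul]
  rw [integral_finsetSum _ fun x hx => hint x (FlowNetwork.mem_pathFinset.1 hx),
    integral_finsetSum _ fun x hx =>
      integrable_condExp.congr (hce x (FlowNetwork.mem_pathFinset.1 hx))]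
  refine Finset.sum_congr rfl fun x hx => ?_
  rw [← integral_condExp hle]
  exact integral_congr_ae (hce x (FlowNetwork.mem_pathFinset.1 hx))

theorem abs_feedback_le (ω : Ω) : |R.c t ω| ≤ 1 :=
  abs_le.2 ⟨by linarith [(R.c_mem t ht ω).1], (R.c_mem t ht ω).2⟩

theorem abs_loss_le (ω : Ω) {y : E → ℝ} (hy : y ∈ G.flows) : |∑ e, R.ℓ t ω e * y e| ≤ 1 := by
  have h0 : 0 ≤ ∑ e, R.ℓ t ω e * y e := Finset.sum_nonneg fun e _ =>
    mul_nonneg (R.ℓ_nonneg t ht ω e) (FlowNetwork.flows_nonneg hy e)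
  rw [abs_of_nonneg h0]
  exact FlowNetwork.sum_le_of_mem_flows (R.ℓ_path_le_one t ht ω) hy

/-- The tower property for conditioning on the past and the path: any bounded weight known from
these sees the feedback only through its conditional mean. -/
theorem integral_feedback_mul [IsProbabilityMeasure μ] (Ψ : Ω → ℝ) (K : ℝ)
    (hΨ : Measurable[R.ℱ t ⊔ MeasurableSpace.comap (R.p t) inferInstance] Ψ)
    (hK : ∀ ω, |Ψ ω| ≤ K) :
    ∫ ω, Ψ ω * R.c t ω ∂μ = ∫ ω, Ψ ω * ∑ e, R.ℓ t ω e * R.p t ω e ∂μ := by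
  have hle : R.ℱ t ⊔ MeasurableSpace.comap (R.p t) inferInstance ≤ mΩ :=
    sup_le (R.ℱ.le t) (R.measurable_path ht).comap_le
  have hc := integrable_of_abs_le (μ := μ) (R.measurable_feedback ht) (R.abs_feedback_le ht)
  have h1 := condExp_stronglyMeasurable_mul_of_bound hle hΨ.stronglyMeasurable hc K
    (Filter.Eventually.of_forall hK)
  have h2 : ∫ ω, Ψ ω * R.c t ω ∂μ = ∫ ω, (Ψ * R.c t) ω ∂μ := rfl
  rw [h2, ← integral_condExp hle]
  refine integral_congr_ae ?_
  filter_upwards [h1, R.c_mean t ht] with ω h3 h4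
  rw [h3, Pi.mul_apply, h4]

theorem measurable_loss_sum {f : Ω → E → ℝ} (hf : Measurable f) :
    Measurable fun ω => ∑ e, R.ℓ t ω e * f ω e :=
  Finset.measurable_sum _ fun e _ => (measurable_pi_iff.1 (R.measurable_loss ht) e).mul
    (measurable_pi_iff.1 hf e)

theorem measurable_lossEstimate (e : E) :
    Measurable fun ω => G.lossEstimate (R.q t ω) (R.p t ω) (R.c t ω) e :=
  (R.measurable_feedback ht).mul ((measurable_importance (G := G) e).comp
    ((R.measurable_flow ht).prodMk (R.measurable_path ht)))

theorem measurable_rho (e : E) :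
    Measurable fun ω => G.rho (R.q t ω) (R.p t ω) (R.c t ω) e := by
  have h1 := (measurable_nodeFlow (G := G) (G.tail e)).comp (R.measurable_path ht)
  have h2 := (measurable_nodeFlow (G := G) (G.tail e)).comp (R.measurable_flow ht)
  have h3 := measurable_pi_iff.1 (R.measurable_path ht) e
  have h4 := measurable_pi_iff.1 (R.measurable_flow ht) e
  exact (((R.measurable_feedback ht).pow_const 2).mul h1).mul ((h3.sub (h4.div h2)).pow_const 2)

variable {δ : ℝ} (hδ : 0 < δ) (hq : ∀ ω, R.q t ω ∈ G.flows)
  (hqδ : ∀ ω e, δ ≤ R.q t ω e)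
include hδ hq hqδ

omit ht in
theorem abs_importance_le {x : E → ℝ} (hx : x ∈ G.paths) (ω : Ω) (e : E) :
    |G.importance (R.q t ω) e x| ≤ 1 / δ := by
  have hpos : ∀ e, 0 < R.q t ω e := fun e => hδ.trans_le (hqδ ω e)
  have h := FlowNetwork.abs_mul_importance_le_one (hq ω) hpos hx e
  rw [abs_mul, abs_of_pos (hpos e)] at h
  rw [le_div_iff₀ hδ]
  nlinarith [hqδ ω e, abs_nonneg (G.importance (R.q t ω) e x)]

omit ht in
theorem abs_sum_importance_le {x y : E → ℝ} (hx : x ∈ G.paths) (hy : y ∈ G.flows) (ω : Ω) :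
    |∑ e, G.importance (R.q t ω) e x * y e| ≤ Fintype.card E * (1 / δ) := by
  refine (Finset.abs_sum_le_sum_abs _ _).trans ?_
  refine (Finset.sum_le_card_nsmul _ _ (1 / δ) fun e _ => ?_).trans (by simp)
  have h := R.abs_importance_le hδ hq hqδ hx ω e
  rw [abs_mul, abs_of_nonneg (FlowNetwork.flows_nonneg hy e)]
  nlinarith [FlowNetwork.flows_le_one hy e, abs_nonneg (G.importance (R.q t ω) e x),
    FlowNetwork.flows_nonneg hy e]

theorem abs_lossEstimate_le (ω : Ω) (e : E) :
    |G.lossEstimate (R.q t ω) (R.p t ω) (R.c t ω) e| ≤ 1 / δ := by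
  have h1 := R.abs_importance_le hδ hq hqδ (R.p_mem t ht ω) ω e
  have h2 := R.abs_feedback_le ht ω
  have h3 : G.lossEstimate (R.q t ω) (R.p t ω) (R.c t ω) e =
    R.c t ω * G.importance (R.q t ω) e (R.p t ω) := rfl
  rw [h3, abs_mul]
  nlinarith [abs_nonneg (R.c t ω), abs_nonneg (G.importance (R.q t ω) e (R.p t ω))]

/-- The loss difference to a fixed flow is estimated without bias. -/
theorem integral_loss_sub [IsProbabilityMeasure μ] [Finite W] [DecidableEq E] {y : E → ℝ} (hy : y ∈ G.flows) :
    ∫ ω, ∑ e, R.ℓ t ω e * (R.p t ω e - y e) ∂μ =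
      -∫ ω, ∑ e, G.lossEstimate (R.q t ω) (R.p t ω) (R.c t ω) e * y e ∂μ := by
  have hpos : ∀ ω e, 0 < R.q t ω e := fun ω e => hδ.trans_le (hqδ ω e)
  have mΨ : Measurable fun z : (E → ℝ) × (E → ℝ) => ∑ e, G.importance z.1 e z.2 * y e :=
    Finset.measurable_sum _ fun e _ => (measurable_importance e).mul_const _
  have h1 : ∫ ω, ∑ e, G.lossEstimate (R.q t ω) (R.p t ω) (R.c t ω) e * y e ∂μ =
      ∫ ω, (∑ e, G.importance (R.q t ω) e (R.p t ω) * y e) * R.c t ω ∂μ := by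
    congr 1
    funext ω
    rw [Finset.sum_mul]
    refine Finset.sum_congr rfl fun e _ => ?_
    change R.c t ω * G.importance (R.q t ω) e (R.p t ω) * y e = _
    ring
  have hmp : Measurable[R.ℱ t ⊔ MeasurableSpace.comap (R.p t) inferInstance] (R.p t) :=
    Measurable.mono (comap_measurable (R.p t)) le_sup_right le_rfl
  have hmq : Measurable[R.ℱ t ⊔ MeasurableSpace.comap (R.p t) inferInstance] (R.q t) :=
    Measurable.mono (R.measurable_q t ht) le_sup_left le_rfl
  have h2 := R.integral_feedback_mul ht
    (fun ω => ∑ e, G.importance (R.q t ω) e (R.p t ω) * y e) (Fintype.card E * (1 / δ))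
    (mΨ.comp (hmq.prodMk hmp))
    (fun ω => R.abs_sum_importance_le hδ hq hqδ (R.p_mem t ht ω) hy ω)
  have mℓ : ∀ z : E → ℝ, Measurable fun w : (E → ℝ) × (E → ℝ) => ∑ e, w.1 e * z e := fun z =>
    Finset.measurable_sum _ fun e _ => ((measurable_pi_apply e).comp measurable_fst).mul_const _
  have mΦ : ∀ x : E → ℝ, Measurable fun w : (E → ℝ) × (E → ℝ) => (∑ e, w.1 e * x e) *
      (∑ e, G.importance w.2 e x * y e) + (∑ e, w.1 e * x e - ∑ e, w.1 e * y e) := fun x =>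
    ((mℓ x).mul (mΨ.comp (measurable_snd.prodMk measurable_const))).add ((mℓ x).sub (mℓ y))
  -- Unbiasedness is put as one function of the path, estimated loss of `y` plus true loss
  -- difference, whose conditional mean vanishes.
  have h3 := R.integral_path ht (fun x ω => (∑ e, R.ℓ t ω e * x e) *
      (∑ e, G.importance (R.q t ω) e x * y e) + (∑ e, R.ℓ t ω e * x e - ∑ e, R.ℓ t ω e * y e))
    (1 * (Fintype.card E * (1 / δ)) + (1 + 1))
    (fun x _ => (mΦ x).comp ((R.measurable_ℓ t ht).prodMk (R.measurable_q t ht)))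
    (fun x hx ω => by
      refine (abs_add_le _ _).trans (add_le_add ?_ ((abs_sub _ _).trans (add_le_add ?_ ?_)))
      · rw [abs_mul]
        exact mul_le_mul (R.abs_loss_le ht ω (FlowNetwork.paths_subset_flows hx))
          (R.abs_sum_importance_le hδ hq hqδ hx hy ω) (abs_nonneg _) zero_le_one
      · exact R.abs_loss_le ht ω (FlowNetwork.paths_subset_flows hx)
      · exact R.abs_loss_le ht ω hy)
  have h4 : ∀ ω, G.walkMean (R.q t ω) G.source (fun x => (∑ e, R.ℓ t ω e * x e) *
      (∑ e, G.importance (R.q t ω) e x * y e) +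
      (∑ e, R.ℓ t ω e * x e - ∑ e, R.ℓ t ω e * y e)) = 0 := by
    intro ω
    have hn : ∀ v, v ≠ G.sink → 0 < G.nodeFlow (R.q t ω) v := fun v =>
      FlowNetwork.nodeFlow_pos_of_ne_sink (hq ω) (hpos ω)
    simp only [sub_eq_add_neg]
    rw [FlowNetwork.walkMean_add, FlowNetwork.walkMean_add, FlowNetwork.walkMean_const hn,
      FlowNetwork.walkMean_loss_sub (hq ω) (hpos ω) _ hy]
    ring
  simp only [h4, integral_zero] at h3
  have mℓp := R.measurable_loss_sum ht (R.measurable_path ht)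
  have mℓy := R.measurable_loss_sum ht (measurable_const (a := y))
  have mΨ' := mΨ.comp ((R.measurable_flow ht).prodMk (R.measurable_path ht))
  rw [integral_add] at h3
  · rw [h1, h2]
    simp only [mul_comm _ (∑ e, R.ℓ t _ e * R.p t _ e)]
    simp only [mul_sub, Finset.sum_sub_distrib]
    linarith
  · refine integrable_of_abs_le (mℓp.mul mΨ') (K := 1 * (Fintype.card E * (1 / δ))) fun ω => ?_
    refine (abs_mul _ _).trans_le ?_
    exact mul_le_mul (R.abs_loss_le ht ω (FlowNetwork.paths_subset_flows (R.p_mem t ht ω)))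
      (R.abs_sum_importance_le hδ hq hqδ (R.p_mem t ht ω) hy ω) (abs_nonneg _) zero_le_one
  · refine integrable_of_abs_le (mℓp.sub mℓy) (K := 1 + 1) fun ω => ?_
    exact (abs_sub _ _).trans (add_le_add
      (R.abs_loss_le ht ω (FlowNetwork.paths_subset_flows (R.p_mem t ht ω)))
      (R.abs_loss_le ht ω hy))

end Expectation

/-! ### Uniform positivity of the iterates and reduction to estimated losses -/

section Iterates

/-- Bounded cumulative estimates keep the iterate uniformly away from zero, which bounds the next
estimate by `1 / δ`; the two facts are propagated together. The bounds are deterministic and do not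
enter the regret bound; they serve integrability only. The bound on `b` may use that earlier
iterates are positive flows, as the adaptive weights need it. -/
theorem exists_lower_bound [Nonempty E] {a : ℕ → ℝ} {b : ℕ → Ω → E → ℝ} {K : ℝ}
    (ha : ∀ t, 0 ≤ a t) (hb : ∀ t ∈ Finset.Icc 1 T, ∀ ω e, 2 ≤ b t ω e)
    (hbK : ∀ t ∈ Finset.Icc 1 T, (∀ τ ∈ Finset.Ico 1 t, ∀ ω,
      R.q τ ω ∈ G.flows ∧ ∀ e, 0 < R.q τ ω e) → ∀ ω e, b t ω e ≤ K)
    (hR : ∀ t ∈ Finset.Icc 1 T, ∀ ω,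
      G.IsFTRLPoint (R.cumLoss t ω) (barrierReg (a t) (b t ω)) (R.q t ω)) :
    ∀ t ∈ Finset.Icc 1 T, ∃ δ, 0 < δ ∧ ∀ ω e, δ ≤ R.q t ω e := by
  have hq : ∀ t ∈ Finset.Icc 1 T, ∀ ω, R.q t ω ∈ G.flows ∧ ∀ e, 0 < R.q t ω e :=
    fun t ht ω => ⟨(hR t ht ω).1, (hR t ht ω).2.1⟩
  have step : ∀ t ∈ Finset.Icc 1 T, (∃ B, ∀ ω e, |R.cumLoss t ω e| ≤ B) →
      ∃ δ, 0 < δ ∧ ∀ ω e, δ ≤ R.q t ω e := by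
    rintro t ht ⟨B, hB⟩
    exact ⟨_, Real.exp_pos _, fun ω e => (hR t ht ω).exp_neg_le (hB ω) (ha t) le_rfl (hb t ht ω)
      (hbK t ht (fun τ hτ => hq τ (by simp at hτ ht ⊢; omega)) ω) e⟩
  have main : ∀ t, 1 ≤ t → t ≤ T → ∃ B, ∀ ω e, |R.cumLoss t ω e| ≤ B := by
    intro t ht
    induction t, ht using Nat.le_induction with
    | base => exact fun _ => ⟨0, fun ω e => by simp [cumLoss]⟩
    | succ k hk ih =>
      intro hkT
      have hkm : k ∈ Finset.Icc 1 T := by simp; omega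
      obtain ⟨B, hB⟩ := ih (by omega)
      obtain ⟨δ, hδ, hqδ⟩ := step k hkm ⟨B, hB⟩
      refine ⟨B + 1 / δ, fun ω e => ?_⟩
      rw [cumLoss, Finset.sum_Ico_succ_top hk]
      exact (abs_add_le _ _).trans (add_le_add (hB ω e)
        (R.abs_lossEstimate_le hkm hδ (fun ω => (hq k hkm ω).1) hqδ ω e))
  intro t ht
  exact step t ht (main t (by simp at ht; omega) (by simp at ht; omega))

variable [IsProbabilityMeasure μ] [Finite W] [DecidableEq E]

/-- The regret is the expected regret on the estimated losses, up to the bias of the comparator. -/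
theorem regretAgainst_le (hq : ∀ t ∈ Finset.Icc 1 T, ∀ ω, R.q t ω ∈ G.flows)
    (hqδ : ∀ t ∈ Finset.Icc 1 T, ∃ δ, 0 < δ ∧ ∀ ω e, δ ≤ R.q t ω e) {x u : E → ℝ}
    (hx : x ∈ G.paths) (hu : u ∈ G.flows) {ε : ℝ}
    (hε : ∀ t ∈ Finset.Icc 1 T, ∀ ω, ∑ e, R.ℓ t ω e * (u e - x e) ≤ ε) :
    R.regretAgainst x ≤ ∫ ω, -∑ t ∈ Finset.Icc 1 T, ∑ e,
      G.lossEstimate (R.q t ω) (R.p t ω) (R.c t ω) e * u e ∂μ + T * ε := by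
  have hint : ∀ t ∈ Finset.Icc 1 T, ∀ f : Ω → E → ℝ, Measurable f → (∀ ω, f ω ∈ G.flows) →
      ∀ y ∈ G.flows, Integrable (fun ω => ∑ e, R.ℓ t ω e * (f ω e - y e)) μ := by
    intro t ht f hf hfm y hy
    have h1 := R.measurable_loss_sum ht hf
    have h2 := R.measurable_loss_sum ht (measurable_const (a := y))
    have h3 := integrable_of_abs_le (μ := μ) (h1.sub h2) (K := 1 + 1) fun ω =>
      (abs_sub _ _).trans (add_le_add (R.abs_loss_le ht ω (hfm ω)) (R.abs_loss_le ht ω hy))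
    refine h3.congr (Filter.Eventually.of_forall fun ω => ?_)
    simp [mul_sub, Finset.sum_sub_distrib]
  have hest : ∀ t ∈ Finset.Icc 1 T, Integrable (fun ω => ∑ e,
      G.lossEstimate (R.q t ω) (R.p t ω) (R.c t ω) e * u e) μ := by
    intro t ht
    obtain ⟨δ, hδ, h⟩ := hqδ t ht
    exact integrable_finsetSum _ fun e _ => (integrable_of_abs_le
      (R.measurable_lossEstimate ht e) (R.abs_lossEstimate_le ht hδ (hq t ht) h · e)).mul_const _
  have hp : ∀ t ∈ Finset.Icc 1 T, ∀ ω, R.p t ω ∈ G.flows := fun t ht ω =>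
    FlowNetwork.paths_subset_flows (R.p_mem t ht ω)
  have hxf := FlowNetwork.paths_subset_flows hx
  rw [regretAgainst, integral_finsetSum _ fun t ht =>
    hint t ht _ (R.measurable_path ht) (hp t ht) x hxf, integral_neg, integral_finsetSum _ hest,
    ← Finset.sum_neg_distrib]
  have h1 : (T : ℝ) * ε = ∑ t ∈ Finset.Icc 1 T, ε := by simp
  rw [h1, ← Finset.sum_add_distrib]
  refine Finset.sum_le_sum fun t ht => ?_
  obtain ⟨δ, hδ, h⟩ := hqδ t ht
  rw [← R.integral_loss_sub ht hδ (hq t ht) h hu]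
  have h2 : ∀ ω, ∑ e, R.ℓ t ω e * (R.p t ω e - x e) ≤
      ∑ e, R.ℓ t ω e * (R.p t ω e - u e) + ε := fun ω => by
    have := hε t ht ω
    simp only [mul_sub, Finset.sum_sub_distrib] at this ⊢
    linarith
  calc _ ≤ ∫ ω, (∑ e, R.ℓ t ω e * (R.p t ω e - u e) + ε) ∂μ :=
        integral_mono (hint t ht _ (R.measurable_path ht) (hp t ht) x hxf)
          ((hint t ht _ (R.measurable_path ht) (hp t ht) u hu).add (integrable_const ε)) h2
    _ = _ := by
        rw [integral_add (hint t ht _ (R.measurable_path ht) (hp t ht) u hu) (integrable_const ε)]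
        simp

theorem regretAgainst_le_card {x : E → ℝ} (hx : x ∈ G.paths) : R.regretAgainst x ≤ T := by
  have h1 : ∀ t ∈ Finset.Icc 1 T, ∀ ω, ∑ e, R.ℓ t ω e * (R.p t ω e - x e) ≤ 1 := by
    intro t ht ω
    have h2 := R.ℓ_path_le_one t ht ω _ (R.p_mem t ht ω)
    have h3 : 0 ≤ ∑ e, R.ℓ t ω e * x e := Finset.sum_nonneg fun e _ =>
      mul_nonneg (R.ℓ_nonneg t ht ω e) (FlowNetwork.flows_nonneg
        (FlowNetwork.paths_subset_flows hx) e)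
    simp only [mul_sub, Finset.sum_sub_distrib]
    linarith
  have h2 : ∀ ω, ∑ t ∈ Finset.Icc 1 T, ∑ e, R.ℓ t ω e * (R.p t ω e - x e) ≤ T := fun ω =>
    (Finset.sum_le_card_nsmul _ _ 1 fun t ht => h1 t ht ω).trans (by simp)
  rw [regretAgainst]
  -- If integrability failed, the integral would be 0 by convention and the bound would hold anyway.
  by_cases hi : Integrable
      (fun ω => ∑ t ∈ Finset.Icc 1 T, ∑ e, R.ℓ t ω e * (R.p t ω e - x e)) μ
  · exact (integral_mono hi (integrable_const (T : ℝ)) h2).trans (by simp)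
  · rw [integral_undef hi]
    positivity

end Iterates

end BanditRun

namespace BanditRun

variable {W E Ω : Type*} [Fintype E] [DecidableEq W] [mΩ : MeasurableSpace Ω]
  {G : FlowNetwork W E} {T : ℕ} {μ : Measure Ω} (R : BanditRun G T μ)

theorem lossEstimate_eq (q x : E → ℝ) (c : ℝ) (e : E) :
    G.lossEstimate q x c e = c * G.importance q e x := rfl

theorem sum_lossEstimate_mul_self [Finite W] {q : E → ℝ} (hq : q ∈ G.flows)
    (hpos : ∀ e, 0 < q e) (x : E → ℝ) (c : ℝ) : ∑ e, G.lossEstimate q x c e * q e = 0 := by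
  simp only [lossEstimate_eq, mul_assoc]
  rw [← Finset.mul_sum, FlowNetwork.sum_importance_mul_self hq hpos, mul_zero]

theorem rho_eq_sq {q x : E → ℝ} (hq : q ∈ G.flows) (hpos : ∀ e, 0 < q e) (hx : x ∈ G.paths)
    (c : ℝ) (e : E) : G.rho q x c e = (q e * G.lossEstimate q x c e) ^ 2 := by
  have := FlowNetwork.sq_mul_importance hq hpos hx e
  rw [lossEstimate_eq, FlowNetwork.rho]
  linear_combination -c ^ 2 * this

theorem abs_mul_lossEstimate_le_one {q x : E → ℝ} (hq : q ∈ G.flows) (hpos : ∀ e, 0 < q e)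
    (hx : x ∈ G.paths) {c : ℝ} (hc : |c| ≤ 1) (e : E) :
    |q e * G.lossEstimate q x c e| ≤ 1 := by
  have h := FlowNetwork.abs_mul_importance_le_one hq hpos hx e
  rw [lossEstimate_eq, show q e * (c * G.importance q e x) = c * (q e * G.importance q e x) by ring,
    abs_mul]
  exact mul_le_one₀ hc (abs_nonneg _) h

/-- Flows are at most 1 on every edge, so the value at the all-ones vector is a uniform bound. -/
theorem integrable_of_mono [IsProbabilityMeasure μ] {f : (E → ℝ) → ℝ} (hf : Measurable f)
    (hf0 : ∀ q ∈ G.flows, 0 ≤ f q) (hf1 : ∀ q ∈ G.flows, f q ≤ f fun _ => 1) {t : ℕ}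
    (ht : t ∈ Finset.Icc 1 T) (hq : ∀ ω, R.q t ω ∈ G.flows) :
    Integrable (fun ω => f (R.q t ω)) μ :=
  integrable_of_abs_le (hf.comp (R.measurable_flow ht)) fun ω => by
    rw [abs_of_nonneg (hf0 _ (hq ω))]
    exact hf1 _ (hq ω)

/-! ### Regret of the Tsallis regularizer -/

section Tsallis

variable [Fintype W] [DecidableEq E]

theorem measurable_sum_sum_sqrt (π : W → E) : Measurable fun q : E → ℝ =>
    ∑ v with v ≠ G.sink, ∑ e with G.tail e = v ∧ e ≠ π v, √(q e) :=
  Finset.measurable_sum _ fun _ _ => Finset.measurable_sum _ fun e _ =>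
    (measurable_pi_apply e).sqrt

theorem sum_sum_sqrt_le (π : W → E) {q : E → ℝ} (hq : q ∈ G.flows) :
    ∑ v with v ≠ G.sink, ∑ e with G.tail e = v ∧ e ≠ π v, √(q e) ≤
      ∑ v with v ≠ G.sink, ∑ e with G.tail e = v ∧ e ≠ π v, √((fun _ : E => (1 : ℝ)) e) :=
  Finset.sum_le_sum fun _ _ => Finset.sum_le_sum fun e _ =>
    Real.sqrt_le_sqrt (FlowNetwork.flows_le_one hq e)

variable [IsProbabilityMeasure μ]

theorem integrable_offPathRoot (x : E → ℝ) (π : W → E) {t : ℕ} (ht : t ∈ Finset.Icc 1 T)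
    (hq : ∀ ω, R.q t ω ∈ G.flows) : Integrable (fun ω => G.offPathRoot x π (R.q t ω)) μ := by
  refine R.integrable_of_mono (f := fun q => G.offPathRoot x π q) ?_
    (fun q _ => FlowNetwork.offPathRoot_nonneg x π q) (fun q hq => ?_) ht hq
  · exact (measurable_sum_sum_sqrt π).add (Finset.measurable_sum _ fun v _ =>
      (measurable_pi_apply (π v)).sqrt)
  · exact add_le_add (sum_sum_sqrt_le π hq) (Finset.sum_le_sum fun v _ =>
      Real.sqrt_le_sqrt (FlowNetwork.flows_le_one hq _))

theorem integral_offPathRoot_le {x : E → ℝ} (hx : x ∈ G.paths) {π : W → E}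
    (hπ : G.Consistent x π) {t : ℕ} (ht : t ∈ Finset.Icc 1 T) (hq : ∀ ω, R.q t ω ∈ G.flows) :
    ∫ ω, G.offPathRoot x π (R.q t ω) ∂μ ≤
      ∫ ω, ((∑ v with v ≠ G.sink, ∑ e with G.tail e = v ∧ e ≠ π v, √(R.q t ω e)) +
        (Finset.card {v : W | v ≠ G.source ∧ v ≠ G.sink} : ℝ) *
          √(∑ v with v = G.source ∨ (v ≠ G.sink ∧ G.nodeFlow x v = 1),
            ∑ e with G.tail e = v ∧ e ≠ π v, R.q t ω e)) ∂μ := by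
  refine integral_mono (R.integrable_offPathRoot x π ht hq) ?_ fun ω =>
    FlowNetwork.offPathRoot_le hx hπ (hq ω)
  refine R.integrable_of_mono (f := fun q =>
    (∑ v with v ≠ G.sink, ∑ e with G.tail e = v ∧ e ≠ π v, √(q e)) +
        (Finset.card {v : W | v ≠ G.source ∧ v ≠ G.sink} : ℝ) *
          √(∑ v with v = G.source ∨ (v ≠ G.sink ∧ G.nodeFlow x v = 1),
            ∑ e with G.tail e = v ∧ e ≠ π v, q e)) ?_ (fun q _ => ?_) (fun q hq => ?_) ht hq
  · exact (measurable_sum_sum_sqrt π).add (measurable_const.mul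
      (Finset.measurable_sum _ fun _ _ => Finset.measurable_sum _ fun e _ =>
        measurable_pi_apply e).sqrt)
  · exact add_nonneg (Finset.sum_nonneg fun _ _ => Finset.sum_nonneg fun _ _ =>
      Real.sqrt_nonneg _) (mul_nonneg (Nat.cast_nonneg _) (Real.sqrt_nonneg _))
  · exact add_le_add (sum_sum_sqrt_le π hq) (mul_le_mul_of_nonneg_left
      (Real.sqrt_le_sqrt (Finset.sum_le_sum fun _ _ => Finset.sum_le_sum fun e _ =>
        FlowNetwork.flows_le_one hq e)) (Nat.cast_nonneg _))

/-- The regret in a single round is at most the probability of leaving the path. -/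
theorem regretAgainst_le_of_one (R : BanditRun G 1 μ)
    (hq : ∀ ω, R.q 1 ω ∈ G.flows ∧ ∀ e, 0 < R.q 1 ω e) {x : E → ℝ} (hx : x ∈ G.paths) {π : W → E}
    (hπ : G.Consistent x π) :
    R.regretAgainst x ≤ ∫ ω, G.offPathRoot x π (R.q 1 ω) ∂μ := by
  have ht : 1 ∈ Finset.Icc 1 1 := by simp
  set κ : E → ℝ := fun e => if x e = 1 then 0 else 1 with hκ
  have hκ0 : ∀ e, 0 ≤ κ e := fun e => by simp only [hκ]; split_ifs <;> norm_num
  have hκ1 : ∀ e, κ e ≤ 1 := fun e => by simp only [hκ]; split_ifs <;> norm_num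
  have hbd : ∀ z ∈ G.flows, |∑ e, κ e * z e| ≤ Fintype.card E := by
    intro z hz
    rw [abs_of_nonneg (Finset.sum_nonneg fun e _ =>
      mul_nonneg (hκ0 e) (FlowNetwork.flows_nonneg hz e))]
    refine (Finset.sum_le_card_nsmul _ _ 1 fun e _ => ?_).trans (by simp)
    exact mul_le_one₀ (hκ1 e) (FlowNetwork.flows_nonneg hz e) (FlowNetwork.flows_le_one hz e)
  have mκ : Measurable fun z : E → ℝ => ∑ e, κ e * z e :=
    Finset.measurable_sum _ fun e _ => (measurable_pi_apply e).const_mul _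
  have hp : ∀ ω, R.p 1 ω ∈ G.flows := fun ω =>
    FlowNetwork.paths_subset_flows (R.p_mem 1 ht ω)
  -- Single-edge losses lie in `[0, 1]`. On edges of `x` the difference `p - 1` is not positive, and
  -- off `x` it is at most `p`.
  have h1 : ∀ ω, ∑ e, R.ℓ 1 ω e * (R.p 1 ω e - x e) ≤ ∑ e, κ e * R.p 1 ω e := fun ω =>
    Finset.sum_le_sum fun e _ => by
      have h0 := R.ℓ_nonneg 1 ht ω e
      have h1 := FlowNetwork.loss_le_one (R.ℓ_nonneg 1 ht ω) (R.ℓ_path_le_one 1 ht ω) e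
      have h2 := FlowNetwork.flows_nonneg (hp ω) e
      have h3 := FlowNetwork.flows_le_one (hp ω) e
      simp only [hκ]
      rcases FlowNetwork.paths_zero_or_one hx e with h | h
      · simp only [h, sub_zero, zero_ne_one, if_false]
        nlinarith
      · simp only [h, if_true]
        nlinarith
  have hi1 : Integrable (fun ω => ∑ e, R.ℓ 1 ω e * (R.p 1 ω e - x e)) μ := by
    have := R.measurable_loss_sum ht (f := fun ω e => R.p 1 ω e - x e)
      ((R.measurable_path ht).sub_const x)
    refine integrable_of_abs_le this (K := 1 + 1) fun ω => ?_
    simp only [mul_sub, Finset.sum_sub_distrib]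
    exact (abs_sub _ _).trans (add_le_add (R.abs_loss_le ht ω (hp ω))
      (R.abs_loss_le ht ω (FlowNetwork.paths_subset_flows hx)))
  have h2 := R.integral_path ht (fun z _ => ∑ e, κ e * z e) (Fintype.card E)
    (fun _ _ => measurable_const) (fun z hz _ => hbd z (FlowNetwork.paths_subset_flows hz))
  have h3 : ∀ ω, G.walkMean (R.q 1 ω) G.source (fun z => ∑ e, κ e * z e) =
      ∑ e, κ e * R.q 1 ω e := by
    intro ω
    rw [FlowNetwork.walkMean_sum]
    refine Finset.sum_congr rfl fun e _ => ?_
    rw [FlowNetwork.walkMean_const_mul, FlowNetwork.walkMean_edge (hq ω).1 (hq ω).2]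
  simp only [h3] at h2
  rw [regretAgainst]
  simp only [Finset.Icc_self, Finset.sum_singleton]
  refine (integral_mono hi1 (integrable_of_abs_le (mκ.comp (R.measurable_path ht))
    fun ω => hbd _ (hp ω)) h1).trans (h2.le.trans ?_)
  refine integral_mono (integrable_of_abs_le (mκ.comp (R.measurable_flow ht))
    fun ω => hbd _ (hq ω).1) (R.integrable_offPathRoot x π ht fun ω => (hq ω).1) fun ω => ?_
  refine le_trans (Finset.sum_le_sum fun e _ => ?_) (FlowNetwork.sum_sqrt_off_path_le hx hπ _)
  simp only [hκ]
  split_ifs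
  · simp
  · rw [one_mul]
    exact Real.le_sqrt_of_sq_le (by
      nlinarith [(hq ω).2 e, FlowNetwork.flows_le_one (hq ω).1 e])

/-- The stability term of the Tsallis regularizer with weight `√t`. -/
noncomputable def tsallisStability (G : FlowNetwork W E) (t : ℕ) (q x : E → ℝ) : ℝ :=
  ∑ e, 4 / (√(t : ℝ) * √(q e)) * (q e * G.importance q e x) ^ 2

theorem measurable_tsallisStability (t : ℕ) :
    Measurable fun z : (E → ℝ) × (E → ℝ) => tsallisStability G t z.1 z.2 := by
  refine Finset.measurable_sum _ fun e _ => ?_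
  have h1 : Measurable fun z : (E → ℝ) × (E → ℝ) => z.1 e :=
    (measurable_pi_apply e).comp measurable_fst
  exact ((h1.sqrt.const_mul _).const_div 4).mul ((h1.mul (measurable_importance e)).pow_const 2)

theorem tsallisStability_nonneg (t : ℕ) (q x : E → ℝ) : 0 ≤ tsallisStability G t q x :=
  Finset.sum_nonneg fun _ _ => by positivity

theorem tsallisStability_le {t : ℕ} (ht : 1 ≤ t) {δ : ℝ} (hδ : 0 < δ) {q x : E → ℝ}
    (hq : q ∈ G.flows) (hqδ : ∀ e, δ ≤ q e) (hx : x ∈ G.paths) :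
    |tsallisStability G t q x| ≤ Fintype.card E * (4 / (√(t : ℝ) * √δ)) := by
  have ht0 : 0 < √(t : ℝ) := Real.sqrt_pos.2 (by exact_mod_cast ht)
  have hδ0 : 0 < √δ := Real.sqrt_pos.2 hδ
  rw [abs_of_nonneg (tsallisStability_nonneg t q x)]
  refine (Finset.sum_le_card_nsmul _ _ (4 / (√(t : ℝ) * √δ)) fun e _ => ?_).trans (by simp)
  have h1 := FlowNetwork.abs_mul_importance_le_one hq (fun e => hδ.trans_le (hqδ e)) hx e
  have h2 : (q e * G.importance q e x) ^ 2 ≤ 1 := by rwa [sq_le_one_iff_abs_le_one]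
  have h3 : 4 / (√(t : ℝ) * √(q e)) ≤ 4 / (√(t : ℝ) * √δ) :=
    div_le_div_of_nonneg_left (by norm_num) (by positivity)
      (mul_le_mul_of_nonneg_left (Real.sqrt_le_sqrt (hqδ e)) ht0.le)
  calc _ ≤ 4 / (√(t : ℝ) * √δ) * 1 := mul_le_mul h3 h2 (sq_nonneg _) (by positivity)
    _ = _ := mul_one _

theorem integrable_tsallisStability {t : ℕ} (ht : t ∈ Finset.Icc 1 T) {δ : ℝ} (hδ : 0 < δ)
    (hq : ∀ ω, R.q t ω ∈ G.flows) (hqδ : ∀ ω e, δ ≤ R.q t ω e) :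
    Integrable (fun ω => tsallisStability G t (R.q t ω) (R.p t ω)) μ :=
  integrable_of_abs_le ((measurable_tsallisStability t).comp
    ((R.measurable_flow ht).prodMk (R.measurable_path ht)))
    fun ω => tsallisStability_le (Finset.mem_Icc.1 ht).1 hδ (hq ω) (hqδ ω) (R.p_mem t ht ω)

/-- The variance identity leaves `(4 / √t) √q (1 - q(e)/q(v))` per edge; charging these to the
unselected edges doubles the constant. -/
theorem integral_tsallisStability_le {x : E → ℝ} {π : W → E}
    (hπ : G.Consistent x π) {t : ℕ} (ht : t ∈ Finset.Icc 1 T) {δ : ℝ} (hδ : 0 < δ)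
    (hq : ∀ ω, R.q t ω ∈ G.flows) (hqδ : ∀ ω e, δ ≤ R.q t ω e) :
    ∫ ω, tsallisStability G t (R.q t ω) (R.p t ω) ∂μ ≤
      8 * (1 / √(t : ℝ) * ∫ ω, G.offPathRoot x π (R.q t ω) ∂μ) := by
  have hpos : ∀ ω e, 0 < R.q t ω e := fun ω e => hδ.trans_le (hqδ ω e)
  have ht1 := (Finset.mem_Icc.1 ht).1
  have ht0 : 0 < √(t : ℝ) := Real.sqrt_pos.2 (by exact_mod_cast ht1)
  rw [R.integral_path ht (fun z ω => tsallisStability G t (R.q t ω) z) _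
    (fun z _ => (measurable_tsallisStability (G := G) t).comp
      ((R.measurable_q t ht).prodMk measurable_const))
    (fun z hz ω => tsallisStability_le ht1 hδ (hq ω) (hqδ ω) hz)]
  have h1 : ∀ ω, G.walkMean (R.q t ω) G.source (fun z => tsallisStability G t (R.q t ω) z) =
      ∑ e, 4 / √(t : ℝ) * (√(R.q t ω e) * (1 - R.q t ω e / G.nodeFlow (R.q t ω) (G.tail e))) := by
    intro ω
    unfold tsallisStability
    rw [FlowNetwork.walkMean_sum]
    refine Finset.sum_congr rfl fun e _ => ?_
    rw [FlowNetwork.walkMean_const_mul,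
      FlowNetwork.walkMean_sq_mul_importance (hq ω) (hpos ω)]
    have hs : 0 < √(R.q t ω e) := Real.sqrt_pos.2 (hpos ω e)
    have hs2 : √(R.q t ω e) * √(R.q t ω e) = R.q t ω e := Real.mul_self_sqrt (hpos ω e).le
    have h2 : 4 / (√(t : ℝ) * √(R.q t ω e)) * R.q t ω e = 4 / √(t : ℝ) * √(R.q t ω e) := by
      nth_rewrite 2 [← hs2]
      field_simp
    rw [← mul_assoc, h2, mul_assoc]
  simp only [h1]
  rw [← mul_assoc, ← integral_const_mul]
  refine integral_mono ?_ ((R.integrable_offPathRoot x π ht hq).const_mul _) fun ω => ?_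
  · refine integrable_finsetSum _ fun e _ => Integrable.const_mul ?_ _
    have m1 : Measurable fun ω => R.q t ω e := measurable_pi_iff.1 (R.measurable_flow ht) e
    have m2 : Measurable fun ω => G.nodeFlow (R.q t ω) (G.tail e) :=
      (measurable_nodeFlow _).comp (R.measurable_flow ht)
    refine integrable_of_abs_le (m1.sqrt.mul ((m1.div m2).const_sub 1)) (K := 1) fun ω => ?_
    have hn := FlowNetwork.nodeFlow_pos_of_ne_sink (hq ω) (hpos ω) (G.tail_ne_sink e)
    have h2 : R.q t ω e / G.nodeFlow (R.q t ω) (G.tail e) ≤ 1 :=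
      (div_le_one hn).2 (FlowNetwork.le_nodeFlow (fun a => (hpos ω a).le) e)
    have h3 : 0 ≤ R.q t ω e / G.nodeFlow (R.q t ω) (G.tail e) :=
      div_nonneg (hpos ω e).le hn.le
    rw [abs_of_nonneg (mul_nonneg (Real.sqrt_nonneg _) (by linarith))]
    exact mul_le_one₀ (Real.sqrt_le_one.2 (FlowNetwork.flows_le_one (hq ω) e)) (by linarith)
      (by linarith)
  · simp only
    rw [← Finset.mul_sum]
    have h2 := FlowNetwork.sum_sqrt_mul_one_sub_le hπ.1 (hq ω) (hpos ω)
    have h3 : 0 ≤ ∑ v with v ≠ G.source ∧ v ≠ G.sink ∧ G.nodeFlow x v ≠ 1,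
      √(R.q t ω (π v)) := Finset.sum_nonneg fun _ _ => Real.sqrt_nonneg _
    calc _ ≤ 4 / √(t : ℝ) * (2 * G.offPathRoot x π (R.q t ω)) := by
          refine mul_le_mul_of_nonneg_left (h2.trans ?_) (by positivity)
          rw [FlowNetwork.offPathRoot]
          linarith
      _ = _ := by ring

/-- Of the `8 m log T`, one half is the barrier of weight 2 at the comparator, the other the `1/T`
by which the comparator may miss 1 on each edge of the path. -/
theorem tsallis_pathwise (hR : R.UsesTsallis) (hT : 2 ≤ T) (ω : Ω) {x u : E → ℝ}
    (hx : x ∈ G.paths) {π : W → E} (hπ : G.Consistent x π) (hu : u ∈ G.flows)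
    (hupos : ∀ e, 0 < u e) (hulog : ∀ e, -Real.log (u e) ≤ 2 * Real.log T)
    (hux : ∀ e, x e = 1 → 1 - 1 / (T : ℝ) ≤ u e) :
    -∑ t ∈ Finset.Icc 1 T, ∑ e, G.lossEstimate (R.q t ω) (R.p t ω) (R.c t ω) e * u e ≤
      ∑ t ∈ Finset.Icc 1 T, (2 / √(t : ℝ) * G.offPathRoot x π (R.q t ω) +
        tsallisStability G t (R.q t ω) (R.p t ω)) + 8 * (Fintype.card E * Real.log T) := by
  have hF : ∀ t ∈ Finset.Icc 1 T, G.IsFTRLPoint (R.cumLoss t ω)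
      (barrierReg √(t : ℝ) fun _ => 2) (R.q t ω) := fun t ht => by
    rw [← tsallisReg_eq_barrierReg]; exact hR t ht ω
  have hT0 : (0 : ℝ) < T := by exact_mod_cast (by omega : 0 < T)
  have hlog := half_le_log hT
  have key := FlowNetwork.ftrl_regret (G := G) (T := T) (q := fun t => R.q t ω)
    (g := fun t => G.lossEstimate (R.q t ω) (R.p t ω) (R.c t ω))
    (ψ := fun t => barrierReg √(t : ℝ) fun _ => 2)
    (st := fun t => tsallisStability G t (R.q t ω) (R.p t ω))
    (fun t ht => ⟨(hF t ht).1, (hF t ht).2.1⟩)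
    (fun t ht y hy hypos => (hF t ht).step
      (sum_lossEstimate_mul_self (hF t ht).1 (hF t ht).2.1 _ _)
      (fun e r hr => by
        have ht0 : 0 < √(t : ℝ) := Real.sqrt_pos.2 (by exact_mod_cast (Finset.mem_Icc.1 ht).1)
        have hqe := (hF t ht).2.1 e
        have hs : 0 < √(R.q t ω e) := Real.sqrt_pos.2 hqe
        have hc := R.abs_feedback_le ht ω
        have h1 := tsallis_stability hqe hr ht0
          (abs_mul_lossEstimate_le_one (hF t ht).1 (hF t ht).2.1 (R.p_mem t ht ω) hc e)
        refine h1.trans ?_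
        rw [lossEstimate_eq, mul_div_right_comm]
        refine mul_le_mul_of_nonneg_left ?_ (by positivity)
        have h2 : R.c t ω ^ 2 ≤ 1 := by rwa [sq_le_one_iff_abs_le_one]
        nlinarith [sq_nonneg (R.q t ω e * G.importance (R.q t ω) e (R.p t ω))]) hy hypos)
    (by omega) hu hupos
  have hψ : ∀ t : ℕ, barrierReg √(t : ℝ) (fun _ => 2) (R.q (t + 1) ω) -
      barrierReg √((t + 1 : ℕ) : ℝ) (fun _ => 2) (R.q (t + 1) ω) =
      2 * (√((t + 1 : ℕ) : ℝ) - √(t : ℝ)) * ∑ e, √(R.q (t + 1) ω e) := fun t => by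
    simp only [barrierReg]; ring
  simp only [hψ] at key
  have h1 : 1 ∈ Finset.Icc 1 T := by simp; omega
  have hpen := sum_sqrt_penalty_le (Q := fun t => ∑ e, √(R.q t ω e))
    (X := fun t => G.offPathRoot x π (R.q t ω)) (U := ∑ e, √(u e))
    (ε := Fintype.card E * (1 / T)) T (by omega)
    (fun t => FlowNetwork.offPathRoot_nonneg _ _ _) (fun t ht => by
      have h2 := FlowNetwork.sum_sqrt_off_path_le hx hπ (R.q t ω)
      -- On the path, `√q ≤ 1 ≤ u + 1/T ≤ √u + 1/T`; off it, `√q` is kept.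
      have h3 : ∑ e, √(R.q t ω e) ≤
          ∑ e, (√(u e) + (if x e = 1 then 0 else √(R.q t ω e)) + 1 / (T : ℝ)) := by
        refine Finset.sum_le_sum fun e _ => ?_
        have hT' : 0 ≤ 1 / (T : ℝ) := by positivity
        have hsu := Real.sqrt_nonneg (u e)
        split_ifs with h
        · have h4 := hux e h
          have h5 : u e ≤ √(u e) := Real.le_sqrt_of_sq_le (by
            nlinarith [hupos e, FlowNetwork.flows_le_one hu e])
          have h6 : √(R.q t ω e) ≤ 1 := Real.sqrt_le_one.2
            (FlowNetwork.flows_le_one (hF t ht).1 e)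
          linarith
        · linarith
      simp only [Finset.sum_add_distrib, Finset.sum_const, Finset.card_univ, nsmul_eq_mul] at h3
      linarith)
  have h2 : 2 * √(T : ℝ) * (Fintype.card E * (1 / T)) ≤ 4 * (Fintype.card E * Real.log T) := by
    have h3 : √(T : ℝ) ≤ T := Real.sqrt_le_self_iff.2 (by right; exact_mod_cast (by omega : 1 ≤ T))
    have h4 : √(T : ℝ) * (1 / T) ≤ 1 := by
      rw [mul_one_div, div_le_one hT0]; exact h3
    have h5 : (0 : ℝ) ≤ Fintype.card E := Nat.cast_nonneg _
    nlinarith [mul_le_mul_of_nonneg_left h4 h5, mul_le_mul_of_nonneg_left hlog h5]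
  have h3 : barrierReg √(T : ℝ) (fun _ => 2) u ≤
      -(2 * √(T : ℝ) * ∑ e, √(u e)) + 4 * (Fintype.card E * Real.log T) := by
    have : ∑ e, -(2 * Real.log (u e)) ≤ 4 * (Fintype.card E * Real.log T) :=
      (Finset.sum_le_card_nsmul _ _ (4 * Real.log T) fun e _ => by linarith [hulog e]).trans
        (le_of_eq (by rw [nsmul_eq_mul, Finset.card_univ]; ring))
    rw [Finset.sum_neg_distrib] at this
    rw [barrierReg]
    linarith
  have h4 : -barrierReg √((1 : ℕ) : ℝ) (fun _ => 2) (R.q 1 ω) ≤ 2 * ∑ e, √(R.q 1 ω e) := by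
    have : ∑ e, 2 * Real.log (R.q 1 ω e) ≤ 0 := Finset.sum_nonpos fun e _ => by
      have := Real.log_nonpos ((hF 1 h1).2.1 e).le (FlowNetwork.flows_le_one (hF 1 h1).1 e)
      linarith
    simp only [barrierReg, Nat.cast_one, Real.sqrt_one]
    linarith
  rw [Finset.sum_add_distrib]
  linarith

theorem tsallis_regretAgainst_le (hR : R.UsesTsallis) {x : E → ℝ} (hx : x ∈ G.paths)
    {π : W → E} (hπ : G.Consistent x π) :
    R.regretAgainst x ≤ 10 * (∑ t ∈ Finset.Icc 1 T, 1 / √(t : ℝ) *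
      (∫ ω, G.offPathRoot x π (R.q t ω) ∂μ) + (Fintype.card E : ℝ) * Real.log T) := by
  have hX : ∀ t : ℕ, 0 ≤ 1 / √(t : ℝ) * ∫ ω, G.offPathRoot x π (R.q t ω) ∂μ := fun t =>
    mul_nonneg (by positivity) (integral_nonneg fun ω => FlowNetwork.offPathRoot_nonneg _ _ _)
  have hXs := Finset.sum_nonneg fun t (_ : t ∈ Finset.Icc 1 T) => hX t
  have hm : (0 : ℝ) ≤ Fintype.card E := Nat.cast_nonneg _
  have hE : Nonempty E := by
    obtain ⟨l, hl, -⟩ := hx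
    cases l with
    | nil => exact absurd hl G.source_ne_sink
    | cons a l => exact ⟨a⟩
  rcases Nat.lt_or_ge T 2 with hT | hT
  · interval_cases T
    · simp [regretAgainst]
    -- Since `log 1 = 0`, no additive term is available, and the regret of the single round is
    -- charged to the roots of the flow off the path.
    · have := R.regretAgainst_le_of_one (fun ω => ⟨(hR 1 (by simp) ω).1, (hR 1 (by simp) ω).2.1⟩)
        hx hπ
      have h1 := hX 1
      simp only [Nat.cast_one, Real.sqrt_one, div_one, one_mul, Finset.Icc_self,
        Finset.sum_singleton, Real.log_one, mul_zero, add_zero] at h1 ⊢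
      linarith
  have hlog := half_le_log hT
  rcases Nat.lt_or_ge T (Fintype.card E) with hTm | hTm
  · have h1 := R.regretAgainst_le_card hx
    have h2 : (T : ℝ) ≤ Fintype.card E := by exact_mod_cast hTm.le
    nlinarith
  have hm1 : (1 : ℝ) ≤ Fintype.card E := by exact_mod_cast Fintype.card_pos
  have hq : ∀ t ∈ Finset.Icc 1 T, ∀ ω, R.q t ω ∈ G.flows := fun t ht ω => (hR t ht ω).1
  have hδ := R.exists_lower_bound (a := fun t => √(t : ℝ)) (b := fun _ _ _ => 2) (K := 2)
    (fun t => Real.sqrt_nonneg _) (fun _ _ _ _ => le_rfl) (fun _ _ _ _ _ => le_rfl)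
    (fun t ht ω => by rw [← tsallisReg_eq_barrierReg]; exact hR t ht ω)
  obtain ⟨u, hu, hupos, hulog, hux, hbias⟩ := FlowNetwork.exists_mixed_flow hT hTm hx
  have hT0 : (T : ℝ) ≠ 0 := by exact_mod_cast (by omega : T ≠ 0)
  have h1 := R.regretAgainst_le hq hδ hx hu fun t ht ω =>
    hbias _ (R.ℓ_nonneg t ht ω) (R.ℓ_path_le_one t ht ω)
  rw [mul_one_div_cancel hT0] at h1
  have hest : ∀ t ∈ Finset.Icc 1 T, Integrable (fun ω => ∑ e,
      G.lossEstimate (R.q t ω) (R.p t ω) (R.c t ω) e * u e) μ := by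
    intro t ht
    obtain ⟨δ, hδ, h⟩ := hδ t ht
    exact integrable_finsetSum _ fun e _ => (integrable_of_abs_le
      (R.measurable_lossEstimate ht e) (R.abs_lossEstimate_le ht hδ (hq t ht) h · e)).mul_const _
  have hi : ∀ t ∈ Finset.Icc 1 T, Integrable (fun ω => 2 / √(t : ℝ) *
      G.offPathRoot x π (R.q t ω) + tsallisStability G t (R.q t ω) (R.p t ω)) μ := by
    intro t ht
    obtain ⟨δ, hδ, h⟩ := hδ t ht
    exact ((R.integrable_offPathRoot x π ht (hq t ht)).const_mul _).add
      (R.integrable_tsallisStability ht hδ (hq t ht) h)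
  have h2 := integral_mono (integrable_finsetSum _ hest).neg
    ((integrable_finsetSum _ hi).add (integrable_const _))
    fun ω => R.tsallis_pathwise hR hT ω hx hπ hu hupos hulog hux
  simp only [Pi.neg_apply, Pi.add_apply] at h2
  rw [integral_add (integrable_finsetSum _ hi) (integrable_const _),
    integral_finsetSum _ hi] at h2
  -- The constant 10 is 2 from the penalty plus 8 from stability.
  have h3 : ∑ t ∈ Finset.Icc 1 T, ∫ ω, (2 / √(t : ℝ) * G.offPathRoot x π (R.q t ω) +
      tsallisStability G t (R.q t ω) (R.p t ω)) ∂μ ≤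
      ∑ t ∈ Finset.Icc 1 T, 10 * (1 / √(t : ℝ) * ∫ ω, G.offPathRoot x π (R.q t ω) ∂μ) := by
    refine Finset.sum_le_sum fun t ht => ?_
    obtain ⟨δ, hδ, h⟩ := hδ t ht
    rw [integral_add ((R.integrable_offPathRoot x π ht (hq t ht)).const_mul _)
      (R.integrable_tsallisStability ht hδ (hq t ht) h), integral_const_mul]
    have h4 := R.integral_tsallisStability_le (x := x) hπ ht hδ (hq t ht) h
    have h5 : 2 / √(t : ℝ) * ∫ ω, G.offPathRoot x π (R.q t ω) ∂μ =
      2 * (1 / √(t : ℝ) * ∫ ω, G.offPathRoot x π (R.q t ω) ∂μ) := by ring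
    linarith
  rw [← Finset.mul_sum] at h3
  simp only [integral_const, probReal_univ, one_smul] at h2
  -- The total bias `T · (1/T) = 1` is at most `2 m log T`, which completes `8 m log T` to `10 m log
  -- T`.
  nlinarith

end Tsallis

/-! ### Regret of the adaptive log-barrier -/

section LogBarrier

theorem rho_nonneg {t : ℕ} (ht : t ∈ Finset.Icc 1 T) (ω : Ω) (e : E) :
    0 ≤ G.rho (R.q t ω) (R.p t ω) (R.c t ω) e := by
  have h : 0 ≤ G.nodeFlow (R.p t ω) (G.tail e) := by
    rcases FlowNetwork.nodeFlow_path (R.p_mem t ht ω) (G.tail e) with h | h <;> rw [h]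
    norm_num
  exact mul_nonneg (mul_nonneg (sq_nonneg _) h) (sq_nonneg _)

theorem rho_le_one {t : ℕ} (ht : t ∈ Finset.Icc 1 T) {ω : Ω} (hq : R.q t ω ∈ G.flows)
    (hpos : ∀ e, 0 < R.q t ω e) (e : E) : G.rho (R.q t ω) (R.p t ω) (R.c t ω) e ≤ 1 := by
  rw [rho_eq_sq hq hpos (R.p_mem t ht ω), sq_le_one_iff_abs_le_one]
  exact abs_mul_lossEstimate_le_one hq hpos (R.p_mem t ht ω) (R.abs_feedback_le ht ω) e

/-- The weight of the logarithmic barrier, the inverse of the learning rate. -/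
noncomputable def barrierWeight (t : ℕ) (ω : Ω) (e : E) : ℝ :=
  √(4 + 1 / Real.log T * ∑ τ ∈ Finset.Ico 1 t, G.rho (R.q τ ω) (R.p τ ω) (R.c τ ω) e)

theorem logBarrierReg_eq (t : ℕ) (ω : Ω) :
    logBarrierReg (R.logBarrierRate t ω) = barrierReg 0 (R.barrierWeight t ω) := by
  rw [logBarrierReg_eq_barrierReg]
  simp only [logBarrierRate, one_div_one_div]
  rfl

theorem sum_rho_nonneg {t : ℕ} (ht : t ≤ T + 1) (ω : Ω) (e : E) :
    0 ≤ ∑ τ ∈ Finset.Ico 1 t, G.rho (R.q τ ω) (R.p τ ω) (R.c τ ω) e :=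
  Finset.sum_nonneg fun τ hτ => R.rho_nonneg (by simp at hτ ⊢; omega) ω e

theorem two_le_barrierWeight (hT : 2 ≤ T) {t : ℕ} (ht : t ∈ Finset.Icc 1 T) (ω : Ω) (e : E) :
    2 ≤ R.barrierWeight t ω e := by
  have h1 := half_le_log hT
  have h2 := R.sum_rho_nonneg (t := t) (by simp at ht; omega) ω e
  refine Real.le_sqrt_of_sq_le ?_
  have : 0 ≤ 1 / Real.log T * ∑ τ ∈ Finset.Ico 1 t, G.rho (R.q τ ω) (R.p τ ω) (R.c τ ω) e :=
    mul_nonneg (one_div_nonneg.2 (by linarith)) h2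
  linarith

/-- The weights grow with `t` and `log q ≤ 0`, so changes of the regularizer only help. The penalty
is paid once, at the comparator with the final weight, and contributes 2 to the constant 6;
stability contributes 4. -/
theorem logBarrier_pathwise [Finite W] (hR : R.UsesLogBarrier) (hT : 2 ≤ T) (ω : Ω) {u : E → ℝ}
    (hu : u ∈ G.flows) (hupos : ∀ e, 0 < u e) (hulog : ∀ e, -Real.log (u e) ≤ 2 * Real.log T) :
    -∑ t ∈ Finset.Icc 1 T, ∑ e, G.lossEstimate (R.q t ω) (R.p t ω) (R.c t ω) e * u e ≤
      6 * ∑ e, √((∑ t ∈ Finset.Icc 1 T, G.rho (R.q t ω) (R.p t ω) (R.c t ω) e) * Real.log T) +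
        4 * (Fintype.card E * Real.log T) := by
  have hF : ∀ t ∈ Finset.Icc 1 T, G.IsFTRLPoint (R.cumLoss t ω)
      (barrierReg 0 (R.barrierWeight t ω)) (R.q t ω) := fun t ht => by
    rw [← logBarrierReg_eq]; exact hR t ht ω
  have hlog := half_le_log hT
  have hL0 : 0 < Real.log T := by linarith
  have hb := fun t ht => R.two_le_barrierWeight hT (t := t) ht ω
  have key := FlowNetwork.ftrl_regret (G := G) (T := T) (q := fun t => R.q t ω)
    (g := fun t => G.lossEstimate (R.q t ω) (R.p t ω) (R.c t ω))
    (ψ := fun t => barrierReg 0 (R.barrierWeight t ω))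
    (st := fun t => ∑ e, 2 * (G.rho (R.q t ω) (R.p t ω) (R.c t ω) e / R.barrierWeight t ω e))
    (fun t ht => ⟨(hF t ht).1, (hF t ht).2.1⟩)
    (fun t ht y hy hypos => (hF t ht).step
      (sum_lossEstimate_mul_self (hF t ht).1 (hF t ht).2.1 _ _)
      (fun e r hr => by
        have h1 := logBarrier_stability ((hF t ht).2.1 e) hr (hb t ht e)
          (abs_mul_lossEstimate_le_one (hF t ht).1 (hF t ht).2.1 (R.p_mem t ht ω)
            (R.abs_feedback_le ht ω) e)
        rw [rho_eq_sq (hF t ht).1 (hF t ht).2.1 (R.p_mem t ht ω), ← mul_div_assoc]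
        simpa using h1) hy hypos)
    (by omega) hu hupos
  have h1 : 1 ∈ Finset.Icc 1 T := by simp; omega
  have hTm : T ∈ Finset.Icc 1 T := by simp; omega
  have hq1 : ∀ t ∈ Finset.Icc 1 T, ∀ e, Real.log (R.q t ω e) ≤ 0 := fun t ht e =>
    Real.log_nonpos ((hF t ht).2.1 e).le (FlowNetwork.flows_le_one (hF t ht).1 e)
  have h2 : ∑ t ∈ Finset.Ico 1 T, (barrierReg 0 (R.barrierWeight t ω) (R.q (t + 1) ω) -
      barrierReg 0 (R.barrierWeight (t + 1) ω) (R.q (t + 1) ω)) ≤ 0 := by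
    refine Finset.sum_nonpos fun t ht => ?_
    have ht' : t + 1 ∈ Finset.Icc 1 T := by simp at ht ⊢; omega
    have ht'' : t ∈ Finset.Icc 1 T := by simp at ht ⊢; omega
    have h3 : ∑ e, R.barrierWeight (t + 1) ω e * Real.log (R.q (t + 1) ω e) ≤
        ∑ e, R.barrierWeight t ω e * Real.log (R.q (t + 1) ω e) := by
      refine Finset.sum_le_sum fun e _ =>
        mul_le_mul_of_nonpos_right (Real.sqrt_le_sqrt ?_) (hq1 _ ht' e)
      rw [Finset.sum_Ico_succ_top (Finset.mem_Icc.1 ht'').1]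
      have := R.rho_nonneg ht'' ω e
      gcongr
      linarith
    simp only [barrierReg]
    linarith
  have h3 : 0 ≤ barrierReg 0 (R.barrierWeight 1 ω) (R.q 1 ω) := by
    have : ∑ e, R.barrierWeight 1 ω e * Real.log (R.q 1 ω e) ≤ 0 :=
      Finset.sum_nonpos fun e _ =>
        mul_nonpos_of_nonneg_of_nonpos (by linarith [hb 1 h1 e]) (hq1 1 h1 e)
    simp only [barrierReg]
    linarith
  have hIco : Finset.Ico 1 (T + 1) = Finset.Icc 1 T := by ext; simp
  have h4 : barrierReg 0 (R.barrierWeight T ω) u ≤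
      2 * ∑ e, √((∑ t ∈ Finset.Icc 1 T, G.rho (R.q t ω) (R.p t ω) (R.c t ω) e) * Real.log T) +
        4 * (Fintype.card E * Real.log T) := by
    have h5 : ∑ e, -(R.barrierWeight T ω e * Real.log (u e)) ≤
        ∑ e, (2 * √((∑ t ∈ Finset.Icc 1 T, G.rho (R.q t ω) (R.p t ω) (R.c t ω) e) *
          Real.log T) + 4 * Real.log T) := by
      refine Finset.sum_le_sum fun e _ => ?_
      have hbe := hb T hTm e
      have hS0 := R.sum_rho_nonneg (t := T) (by omega) ω e
      have hSle : ∑ t ∈ Finset.Ico 1 T, G.rho (R.q t ω) (R.p t ω) (R.c t ω) e ≤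
          ∑ t ∈ Finset.Icc 1 T, G.rho (R.q t ω) (R.p t ω) (R.c t ω) e := by
        rw [← hIco, Finset.sum_Ico_succ_top (by omega)]
        linarith [R.rho_nonneg hTm ω e]
      obtain ⟨S, hS⟩ : ∃ S, S = ∑ t ∈ Finset.Ico 1 T, G.rho (R.q t ω) (R.p t ω) (R.c t ω) e :=
        ⟨_, rfl⟩
      -- Squaring the left side gives `4 (log T)² + S log T`, at most the square of the right side.
      -- Together with `-log u ≤ 2 log T` it bounds the barrier at `u`.
      have h6 : R.barrierWeight T ω e * Real.log T ≤ √(S * Real.log T) + 2 * Real.log T := by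
        have h7 : 0 ≤ √(S * Real.log T) := Real.sqrt_nonneg _
        have h8 : √(S * Real.log T) ^ 2 = S * Real.log T :=
          Real.sq_sqrt (mul_nonneg (hS ▸ hS0) hL0.le)
        refine abs_le_of_sq_le_sq' ?_ (by positivity) |>.2
        rw [mul_pow, barrierWeight, ← hS, Real.sq_sqrt (by rw [hS]; positivity)]
        have : (4 + 1 / Real.log T * S) * Real.log T ^ 2 =
          4 * Real.log T ^ 2 + S * Real.log T := by field_simp
        nlinarith
      have h9 : √(S * Real.log T) ≤
          √((∑ t ∈ Finset.Icc 1 T, G.rho (R.q t ω) (R.p t ω) (R.c t ω) e) * Real.log T) :=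
        Real.sqrt_le_sqrt (mul_le_mul_of_nonneg_right (hS ▸ hSle) hL0.le)
      nlinarith [hulog e]
    rw [Finset.sum_neg_distrib, Finset.sum_add_distrib, ← Finset.mul_sum, Finset.sum_const,
      Finset.card_univ, nsmul_eq_mul] at h5
    simp only [barrierReg]
    linarith
  have h5 : ∑ t ∈ Finset.Icc 1 T, ∑ e,
      2 * (G.rho (R.q t ω) (R.p t ω) (R.c t ω) e / R.barrierWeight t ω e) ≤
      4 * ∑ e, √((∑ t ∈ Finset.Icc 1 T, G.rho (R.q t ω) (R.p t ω) (R.c t ω) e) *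
        Real.log T) := by
    rw [Finset.sum_comm, Finset.mul_sum]
    refine Finset.sum_le_sum fun e _ => ?_
    rw [← Finset.mul_sum, ← hIco]
    have := sum_div_sqrt_le (ρ := fun t => G.rho (R.q t ω) (R.p t ω) (R.c t ω) e) hlog (T + 1)
      (fun t ht => R.rho_nonneg (hIco ▸ ht) ω e)
      (fun t ht => R.rho_le_one (hIco ▸ ht) (hF t (hIco ▸ ht)).1 (hF t (hIco ▸ ht)).2.1 e)
    have h6 : ∑ t ∈ Finset.Ico 1 (T + 1),
        G.rho (R.q t ω) (R.p t ω) (R.c t ω) e / R.barrierWeight t ω e ≤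
        2 * √((∑ t ∈ Finset.Ico 1 (T + 1), G.rho (R.q t ω) (R.p t ω) (R.c t ω) e) *
          Real.log T) := this
    linarith
  linarith

theorem logBarrier_regretAgainst_le [Finite W] [DecidableEq E] [IsProbabilityMeasure μ]
    (hR : R.UsesLogBarrier) (hT : 2 ≤ T) {x : E → ℝ} (hx : x ∈ G.paths) :
    R.regretAgainst x ≤ 10 * (∫ ω, ∑ e, √((∑ t ∈ Finset.Icc 1 T,
      G.rho (R.q t ω) (R.p t ω) (R.c t ω) e) * Real.log T) ∂μ +
        (Fintype.card E : ℝ) * Real.log T) := by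
  have hXs : 0 ≤ ∫ ω, ∑ e, √((∑ t ∈ Finset.Icc 1 T,
      G.rho (R.q t ω) (R.p t ω) (R.c t ω) e) * Real.log T) ∂μ :=
    integral_nonneg fun ω => Finset.sum_nonneg fun _ _ => Real.sqrt_nonneg _
  have hm : (0 : ℝ) ≤ Fintype.card E := Nat.cast_nonneg _
  have hE : Nonempty E := by
    obtain ⟨l, hl, -⟩ := hx
    cases l with
    | nil => exact absurd hl G.source_ne_sink
    | cons a l => exact ⟨a⟩
  have hlog := half_le_log hT
  have hL0 : 0 < Real.log T := by linarith
  rcases Nat.lt_or_ge T (Fintype.card E) with hTm | hTm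
  · have h1 := R.regretAgainst_le_card hx
    have h2 : (T : ℝ) ≤ Fintype.card E := by exact_mod_cast hTm.le
    nlinarith
  have hm1 : (1 : ℝ) ≤ Fintype.card E := by exact_mod_cast Fintype.card_pos
  have hq : ∀ t ∈ Finset.Icc 1 T, ∀ ω, R.q t ω ∈ G.flows := fun t ht ω => (hR t ht ω).1
  have hpos : ∀ t ∈ Finset.Icc 1 T, ∀ ω e, 0 < R.q t ω e := fun t ht ω => (hR t ht ω).2.1
  have hδ := R.exists_lower_bound (a := fun _ => 0) (b := R.barrierWeight)
    (K := √(4 + 1 / Real.log T * T)) (fun _ => le_rfl)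
    (fun t ht ω e => R.two_le_barrierWeight hT ht ω e)
    -- Each `rho` is at most 1 and fewer than `T` of them enter, so the weights have a deterministic
    -- upper bound.
    (fun t ht h ω e => Real.sqrt_le_sqrt (by
      gcongr
      refine (Finset.sum_le_card_nsmul _ _ 1 fun τ hτ => ?_).trans ?_
      · exact R.rho_le_one (by simp at hτ ht ⊢; omega) (h τ hτ ω).1 (h τ hτ ω).2 e
      · rw [nsmul_eq_mul, mul_one, Nat.card_Ico]
        exact_mod_cast (by simp at ht; omega)))
    (fun t ht ω => by rw [← logBarrierReg_eq]; exact hR t ht ω)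
  obtain ⟨u, hu, hupos, hulog, -, hbias⟩ := FlowNetwork.exists_mixed_flow hT hTm hx
  have hT0 : (T : ℝ) ≠ 0 := by exact_mod_cast (by omega : T ≠ 0)
  have h1 := R.regretAgainst_le hq hδ hx hu fun t ht ω =>
    hbias _ (R.ℓ_nonneg t ht ω) (R.ℓ_path_le_one t ht ω)
  rw [mul_one_div_cancel hT0] at h1
  have hest : ∀ t ∈ Finset.Icc 1 T, Integrable (fun ω => ∑ e,
      G.lossEstimate (R.q t ω) (R.p t ω) (R.c t ω) e * u e) μ := by
    intro t ht
    obtain ⟨δ, hδ, h⟩ := hδ t ht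
    exact integrable_finsetSum _ fun e _ => (integrable_of_abs_le
      (R.measurable_lossEstimate ht e) (R.abs_lossEstimate_le ht hδ (hq t ht) h · e)).mul_const _
  have hi : Integrable (fun ω => ∑ e, √((∑ t ∈ Finset.Icc 1 T,
      G.rho (R.q t ω) (R.p t ω) (R.c t ω) e) * Real.log T)) μ := by
    refine integrable_finsetSum _ fun e _ => ?_
    have m1 : Measurable fun ω => ∑ t ∈ Finset.Icc 1 T,
        G.rho (R.q t ω) (R.p t ω) (R.c t ω) e :=
      Finset.measurable_sum _ fun t ht => R.measurable_rho ht e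
    refine integrable_of_abs_le (m1.mul_const _).sqrt (K := √(T * Real.log T)) fun ω => ?_
    rw [abs_of_nonneg (Real.sqrt_nonneg _)]
    refine Real.sqrt_le_sqrt (mul_le_mul_of_nonneg_right ?_ hL0.le)
    exact (Finset.sum_le_card_nsmul _ _ 1 fun t ht =>
      R.rho_le_one ht (hq t ht ω) (hpos t ht ω) e).trans (by simp)
  have h2 := integral_mono (integrable_finsetSum _ hest).neg
    ((hi.const_mul 6).add (integrable_const _))
    fun ω => R.logBarrier_pathwise hR hT ω hu hupos hulog
  simp only [Pi.neg_apply, Pi.add_apply] at h2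
  rw [integral_add (hi.const_mul 6) (integrable_const _), integral_const_mul] at h2
  simp only [integral_const, probReal_univ, one_smul] at h2
  nlinarith

end LogBarrier

end BanditRun

/-! ### The theorem, with constant 10 -/

theorem mainTheorem4 :
    ∃ C : ℝ, 0 < C ∧
      ∀ (W E Ω : Type*) [Fintype W] [DecidableEq W] [Fintype E] [DecidableEq E]
        [MeasurableSpace Ω] (μ : MeasureTheory.Measure Ω) [MeasureTheory.IsProbabilityMeasure μ]
        (G : FlowNetwork W E) (T : ℕ) (R : BanditRun G T μ),
        (R.UsesTsallis → ∀ x ∈ G.paths, ∀ π : W → E, G.Consistent x π →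
          R.regretAgainst x ≤
            C * (∑ t ∈ Finset.Icc 1 T, 1 / √(t : ℝ) *
                (∫ ω, ((∑ v with v ≠ G.sink, ∑ e with G.tail e = v ∧ e ≠ π v, √(R.q t ω e)) +
                  ∑ v with v ≠ G.source ∧ v ≠ G.sink ∧ G.nodeFlow x v ≠ 1,
                    √(R.q t ω (π v))) ∂μ)
              + (Fintype.card E : ℝ) * Real.log T) ∧
          (∑ t ∈ Finset.Icc 1 T, 1 / √(t : ℝ) *
              (∫ ω, ((∑ v with v ≠ G.sink, ∑ e with G.tail e = v ∧ e ≠ π v, √(R.q t ω e)) +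
                ∑ v with v ≠ G.source ∧ v ≠ G.sink ∧ G.nodeFlow x v ≠ 1,
                  √(R.q t ω (π v))) ∂μ)
              + (Fintype.card E : ℝ) * Real.log T ≤
            ∑ t ∈ Finset.Icc 1 T, 1 / √(t : ℝ) *
              (∫ ω, ((∑ v with v ≠ G.sink, ∑ e with G.tail e = v ∧ e ≠ π v, √(R.q t ω e)) +
                (Finset.card {v : W | v ≠ G.source ∧ v ≠ G.sink} : ℝ) *
                  √(∑ v with v = G.source ∨ (v ≠ G.sink ∧ G.nodeFlow x v = 1),
                    ∑ e with G.tail e = v ∧ e ≠ π v, R.q t ω e)) ∂μ)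
              + (Fintype.card E : ℝ) * Real.log T)) ∧
        (R.UsesLogBarrier → 2 ≤ T →
          R.regret ≤
            C * ((∫ ω, ∑ v with v ≠ G.sink, ∑ e with G.tail e = v,
                √((∑ t ∈ Finset.Icc 1 T, R.c t ω ^ 2 * G.nodeFlow (R.p t ω) v *
                    (R.p t ω e - R.q t ω e / G.nodeFlow (R.q t ω) v) ^ 2) * Real.log T) ∂μ)
              + (Fintype.card E : ℝ) * Real.log T)) := by
  refine ⟨10, by norm_num, ?_⟩
  intro W E Ω _ _ _ _ _ μ _ G T R
  refine ⟨fun hR x hx π hπ => ⟨R.tsallis_regretAgainst_le hR hx hπ, ?_⟩, fun hR hT => ?_⟩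
  · refine add_le_add (Finset.sum_le_sum fun t ht => ?_) le_rfl
    exact mul_le_mul_of_nonneg_left
      (R.integral_offPathRoot_le hx hπ ht fun ω => (hR t ht ω).1) (by positivity)
  · have hlog := half_le_log hT
    simp only [FlowNetwork.sum_sum_tail]
    -- A real supremum over an empty family is 0, so the bound must also be shown nonnegative.
    refine Real.iSup_le (fun x => R.logBarrier_regretAgainst_le hR hT x.2) ?_
    have h1 : (0 : ℝ) ≤ Fintype.card E * Real.log T :=
      mul_nonneg (Nat.cast_nonneg _) (by linarith)
    have h2 : 0 ≤ ∫ ω, ∑ e, √((∑ t ∈ Finset.Icc 1 T,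
        G.rho (R.q t ω) (R.p t ω) (R.c t ω) e) * Real.log T) ∂μ :=
      integral_nonneg fun ω => Finset.sum_nonneg fun e _ => Real.sqrt_nonneg _
    exact mul_nonneg (by norm_num) (add_nonneg h2 h1)
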